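/- Let $K$ be a CM field with maximal totally real subfield $E$, let $x\mapsto\bar x$ denote the involution of $K\otimes_E R$ coming from complex conjugation ($R$ any $E$-algebra), and put $\mathbb A_K=K\otimes_E\mathbb A_E$. For an $E$-algebra $R$ let $\mathrm{Her}_n(K\otimes_E R)$ be the group of hermitian $n\times n$ matrices over $K\otimes_E R$, let $\eta=\begin{pmatrix}0&-1_n\\1_n&0\end{pmatrix}$, $G(R)=\{g\in \mathrm{GL}_{2n}(K\otimes_E R): g\,\eta\,{}^t\bar g=\eta\}$, $m(h)=\mathrm{diag}({}^t\bar h^{-1},h)$ for $h\in \mathrm{GL}_n(K\otimes_E R)$, and $n(b)=\begin{pmatrix}1&b\\0&1\end{pmatrix}$ for $b\in\mathrm{Her}_n(K\otimes_E R)$; let $P$ be the subgroup of all $m(h)n(b)$. Let $\chi:K^\times\backslash\mathbb A_K^\times\to\mathbb C^\times$ be a unitary Hecke character, with local components $\chi_v$ on $(K\otimes_E E_v)^\times$; for a matrix $g$ write $\chi(g)=\chi(\det g)$. For a place $v$ of $E$ let $|\cdot|_v$ be the normalized absolute value of $E_v$, let $|a|_v=|a\bar a|_v^{1/2}$ for $a\in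 K\otimes_E E_v$, and let $|a|_E=\prod_v|a_v|_v$ for $a\in\mathbb A_E^\times$. Let $s\in\mathbb C$ and let $f=\otimes_v f_v$ ($v$ running over the places of $E$) be a factorizable section in $\mathrm{Ind}_{P(\mathbb A_E)}^{G(\mathbb A_E)}(\chi|\cdot|_K^{-s})$: the $f_v:G(E_v)\to\mathbb C$ satisfy $$f_v(m(a)n(b)g)=\chi_v(\det a)\,|\det a|_v^{-2s}f_v(g),$$ and $f_v=1$ on $G(\mathcal O_{E_v})$ for almost all finite $v$. For $\beta\in\mathrm{Her}_n(\mathbb A_K)$ and $h\in\mathrm{GL}_n(\mathbb A_K)$ the Fourier coefficient is $$c(\beta,h;f)=C(n,K)\prod_v\int_{\mathrm{Her}_n(K\otimes_E E_v)}f_v\bigl(\eta\, n(x)\, m(h_v)\bigr)\,\mathbf e_v(-\mathrm{tr}(\beta_v x))\,d_vx .$$ Here $C(n,K)=2^{n(n-1)[E:\mathbb Q]/2}|D_E|^{-n/2}|D_K|^{-n(n-1)/4}$ with $D_E,D_K$ the discriminants; $\mathbf e_v(x)=e^{2\pi i x}$ for $v\mid\infty$, and $\mathbf e_v(x)=e^{-2\pi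 i y}$ for $v\mid q<\infty$, where $y\in\mathbb Z[1/q]$ and $\mathrm{tr}_{E_v/\mathbb Q_q}(x)-y\in\mathbb Z_q$; $d_vx$ is the Haar measure giving $\mathrm{Her}_n(\mathcal O_K\otimes\mathcal O_{E_v})$ volume $1$ for finite $v$, and $\bigl|\bigwedge_j dx_{jj}\wedge\bigwedge_{j<k}(2^{-1}dx_{jk}\wedge d\bar x_{jk})\bigr|$ for $v\mid\infty$. We say that $c(\beta,h;f)$ converges if all the local integrals converge absolutely and their product converges unconditionally. **Lemma 9.** Let $h\in\mathrm{GL}_n(\mathbb A_K)$ and $\beta\in\mathrm{Her}_n(K)$. Then $c(\beta,h;f)$ converges if and only if $c(h^{-1}\beta\,{}^t\bar h^{-1},1_n;f)$ does, and in that case $$c(\beta,h;f)=\chi({}^t\bar h^{-1})\,\bigl|\det({}^t\bar h^{-1}h^{-1})\bigr|_E^{\,n-s}\;c(h^{-1}\beta\,{}^t\bar h^{-1},1_n;f).$$ The same identity holds for analytic continuations in $s$: if $f_s$ is such a section for each $s\in\mathbb C$, $D\subset\mathbb C$ is open and connected, $F$ and $F_1$ are holomorphic on $D$, and for all $s$ in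 a neighbourhood of some $s_0\in D$ the coefficients converge and $F(s)=c(\beta,h;f_s)$, $F_1(s)=c(h^{-1}\beta\,{}^t\bar h^{-1},1_n;f_s)$, then $F(s)=\chi({}^t\bar h^{-1})|\det({}^t\bar h^{-1}h^{-1})|_E^{n-s}F_1(s)$ for all $s\in D$. -/

import Mathlib

open NumberField IsDedekindDomain MeasureTheory Matrix Filter Topology
open scoped TensorProduct ENNReal

noncomputable section

namespace SiegelEisenstein

/-! ## The algebras `K ⊗_E R`

`K` is a CM field and `E` is its maximal totally real subfield. -/

/-- The maximal totally real subfield `E` of the CM field `K`. -/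
abbrev RealField (K : Type*) [Field K] : Type _ := maximalRealSubfield K

/-- For an `E`-algebra `R`, the `R`-algebra `R ⊗_E K`. For `R = E_v` this is the product of the
completions of `K` above `v`, and for `R = 𝔸_E` it is the adele ring of `K`. -/
def KTensor (K : Type*) [Field K] (R : Type*) [CommRing R] [Algebra (RealField K) R] : Type _ :=
  R ⊗[RealField K] K

namespace KTensor

section Ring

variable (K : Type*) [Field K] (R : Type*) [CommRing R] [Algebra (RealField K) R]

instance : CommRing (KTensor K R) := inferInstanceAs (CommRing (R ⊗[RealField K] K))

instance : Algebra R (KTensor K R) := inferInstanceAs (Algebra R (R ⊗[RealField K] K))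

instance [NumberField K] : Module.Finite R (KTensor K R) :=
  inferInstanceAs (Module.Finite R (R ⊗[RealField K] K))

instance : Module.Free R (KTensor K R) :=
  inferInstanceAs (Module.Free R (R ⊗[RealField K] K))

/-- The canonical map `K → K ⊗_E R`. -/
def ofField : K →+* KTensor K R :=
  (Algebra.TensorProduct.includeRight : K →ₐ[RealField K] R ⊗[RealField K] K).toRingHom

variable {R} in
/-- The ring homomorphism `K ⊗_E R → K ⊗_E S` induced by a homomorphism of `E`-algebras `R → S`. -/
def map {S : Type*} [CommRing S] [Algebra (RealField K) S] (φ : R →ₐ[RealField K] S) :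
    KTensor K R →+* KTensor K S :=
  (Algebra.TensorProduct.map φ (AlgHom.id (RealField K) K) :
    R ⊗[RealField K] K →ₐ[RealField K] S ⊗[RealField K] K).toRingHom

/-- The `R`-linear projection of `K ⊗_E R` onto `R` given by half the trace. On the elements
that are fixed by the involution it is the inverse of `R → K ⊗_E R`, see `algebraMap_descend`. -/
def descend : KTensor K R →ₗ[R] R :=
  (algebraMap (RealField K) R (1 / 2)) • Algebra.trace R (KTensor K R)

end Ring

section Star

theorem two_mul_half (K R : Type*) [Field K] [CharZero K] [CommRing R] [Algebra (RealField K) R] :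
    (2 : R) * algebraMap (RealField K) R (1 / 2) = 1 := by
  rw [← map_ofNat (algebraMap (RealField K) R) 2, ← map_mul]
  norm_num

variable (K : Type*) [Field K] [NumberField K] [IsCMField K]
  (R : Type*) [CommRing R] [Algebra (RealField K) R]

/-- The involution of `K ⊗_E R` coming from complex conjugation on `K`. -/
def conj : KTensor K R ≃ₐ[R] KTensor K R :=
  (Algebra.TensorProduct.congr AlgEquiv.refl (IsCMField.complexConj K) :
    R ⊗[RealField K] K ≃ₐ[R] R ⊗[RealField K] K)

variable {K R} in
theorem conj_conj (x : KTensor K R) : conj K R (conj K R x) = x := by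
  induction x using TensorProduct.induction_on with
  | zero => exact (congrArg (conj K R) (map_zero (conj K R))).trans (map_zero (conj K R))
  | tmul a b =>
    change a ⊗ₜ[RealField K] (IsCMField.complexConj K (IsCMField.complexConj K b)) = a ⊗ₜ b
    rw [IsCMField.complexConj_apply_apply]
  | add x y hx hy =>
    exact ((congrArg (conj K R) (map_add (conj K R) x y)).trans
      (map_add (conj K R) _ _)).trans (congrArg₂ _ hx hy)

instance : StarRing (KTensor K R) where
  star x := conj K R x
  star_involutive := conj_conj
  star_mul x y := by rw [map_mul, mul_comm]
  star_add x y := map_add _ x y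

variable {K R}

theorem star_def (x : KTensor K R) : star x = conj K R x := rfl

theorem map_star {S : Type*} [CommRing S] [Algebra (RealField K) S] (φ : R →ₐ[RealField K] S)
    (x : KTensor K R) : map K φ (star x) = star (map K φ x) := by
  induction x using TensorProduct.induction_on with
  | zero => exact ((map K φ).map_zero.trans (star_zero _).symm : _)
  | tmul a b => rfl
  | add x y hx hy =>
    have h1 : map K φ (star (x + y)) = map K φ (star x) + map K φ (star y) := by
      rw [← map_add]; exact congrArg _ (star_add (R := KTensor K R) x y)
    have h2 : star (map K φ (x + y)) = star (map K φ x) + star (map K φ y) := by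
      rw [← star_add]; exact congrArg _ (map_add (map K φ) x y)
    exact h1.trans ((congrArg₂ _ hx hy).trans h2.symm)

theorem ofField_star (x : K) : ofField K R (star x) = star (ofField K R x) := by
  change (1 : R) ⊗ₜ[RealField K] (IsCMField.complexConj K x) = _
  rw [star_def]
  change _ = (Algebra.TensorProduct.congr AlgEquiv.refl (IsCMField.complexConj K))
    ((1 : R) ⊗ₜ[RealField K] x)
  simp

theorem trace_tmul (r : R) (k : K) :
    Algebra.trace R (R ⊗[RealField K] K) (r ⊗ₜ[RealField K] k)
      = r * algebraMap (RealField K) R (Algebra.trace (RealField K) K k) := by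
  have h : Algebra.lmul R (R ⊗[RealField K] K) (r ⊗ₜ[RealField K] k)
      = r • (Algebra.lmul (RealField K) K k).baseChange R := by
    refine TensorProduct.AlgebraTensorModule.curry_injective ?_
    ext x
    simp [TensorProduct.smul_tmul']
  rw [Algebra.trace_apply, h, map_smul, LinearMap.trace_baseChange, ← Algebra.trace_apply,
    smul_eq_mul]

theorem algebraMap_trace_field (k : K) :
    algebraMap (RealField K) K (Algebra.trace (RealField K) K k) = k + IsCMField.complexConj K k := by
  classical
  rw [trace_eq_sum_automorphisms]
  have h : (Finset.univ : Finset (K ≃ₐ[RealField K] K)) = {1, IsCMField.complexConj K} := by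
    symm
    apply Finset.eq_univ_of_card
    rw [Finset.card_pair (IsCMField.complexConj_ne_one K).symm, ← Nat.card_eq_fintype_card,
      IsGalois.card_aut_eq_finrank, Algebra.IsQuadraticExtension.finrank_eq_two]
  rw [h, Finset.sum_pair (IsCMField.complexConj_ne_one K).symm]
  rfl

/-- The trace of `x ∈ K ⊗_E R` is `x + x̄`. -/
theorem algebraMap_trace (x : KTensor K R) :
    algebraMap R (KTensor K R) (Algebra.trace R (KTensor K R) x) = x + star x := by
  let f : R ⊗[RealField K] K →ₗ[R] R ⊗[RealField K] K :=
    (Algebra.linearMap R (R ⊗[RealField K] K)).comp (Algebra.trace R (R ⊗[RealField K] K))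
  let g : R ⊗[RealField K] K →ₗ[R] R ⊗[RealField K] K :=
    LinearMap.id + (conj K R).toLinearMap
  have h : f = g := by
    refine TensorProduct.AlgebraTensorModule.curry_injective ?_
    ext k
    change algebraMap R (R ⊗[RealField K] K)
      (Algebra.trace R (R ⊗[RealField K] K) ((1 : R) ⊗ₜ[RealField K] k))
      = (1 : R) ⊗ₜ[RealField K] k + (1 : R) ⊗ₜ[RealField K] (IsCMField.complexConj K k)
    rw [trace_tmul, one_mul, ← TensorProduct.tmul_add, ← algebraMap_trace_field,
      Algebra.algebraMap_eq_smul_one (A := K), TensorProduct.tmul_smul,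
      Algebra.TensorProduct.algebraMap_apply, TensorProduct.smul_tmul', Algebra.smul_def, mul_one]
    rfl
  exact DFunLike.congr_fun h x

/-- An element of `K ⊗_E R` that is fixed by the involution is the image of `descend x ∈ R`. -/
theorem algebraMap_descend (x : KTensor K R) (hx : star x = x) :
    algebraMap R (KTensor K R) (descend K R x) = x := by
  have h : descend K R x = algebraMap (RealField K) R (1 / 2) * Algebra.trace R (KTensor K R) x :=
    rfl
  rw [h, map_mul, algebraMap_trace, hx, ← two_mul, ← mul_assoc, mul_comm _ 2,
    ← map_ofNat (algebraMap R (KTensor K R)) 2, ← map_mul, two_mul_half K R, map_one, one_mul]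

/-- `descend` is a left inverse of the inclusion `R → K ⊗_E R`. -/
theorem descend_algebraMap (a : R) : descend K R (algebraMap R (KTensor K R) a) = a := by
  have h : descend K R (algebraMap R (KTensor K R) a)
      = algebraMap (RealField K) R (1 / 2) *
        Algebra.trace R (R ⊗[RealField K] K) (a ⊗ₜ[RealField K] (1 : K)) := rfl
  have h2 : Algebra.trace (RealField K) K 1 = 2 := by
    rw [← map_one (algebraMap (RealField K) K), Algebra.trace_algebraMap,
      Algebra.IsQuadraticExtension.finrank_eq_two]
    simp
  rw [h, trace_tmul, h2, map_ofNat, mul_left_comm, mul_comm _ (2 : R), two_mul_half K R, mul_one]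

end Star

section Topology

variable (K : Type*) [Field K] [NumberField K]
  (R : Type*) [CommRing R] [Algebra (RealField K) R] [TopologicalSpace R] [IsTopologicalRing R]

/-- `K ⊗_E R` carries its topology as a free `R`-module of finite rank (that of `R ^ 2`). -/
instance : TopologicalSpace (KTensor K R) := moduleTopology R (KTensor K R)

instance : IsModuleTopology R (KTensor K R) := ⟨rfl⟩

instance : IsTopologicalRing (KTensor K R) := IsModuleTopology.isTopologicalRing R (KTensor K R)

/-- A choice of coordinates on `K ⊗_E R`. -/
def homeomorph : KTensor K R ≃ₜ (Module.Free.ChooseBasisIndex R (KTensor K R) → R) where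
  toEquiv := (Module.Free.chooseBasis R (KTensor K R)).equivFun.toEquiv
  continuous_toFun := IsModuleTopology.continuous_of_linearMap
    (Module.Free.chooseBasis R (KTensor K R)).equivFun.toLinearMap
  continuous_invFun := IsModuleTopology.continuous_of_linearMap
    (Module.Free.chooseBasis R (KTensor K R)).equivFun.symm.toLinearMap

instance [T2Space R] : T2Space (KTensor K R) := (homeomorph K R).symm.t2Space

instance [LocallyCompactSpace R] : LocallyCompactSpace (KTensor K R) :=
  (homeomorph K R).isClosedEmbedding.locallyCompactSpace

instance [IsCMField K] : ContinuousStar (KTensor K R) where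
  continuous_star := IsModuleTopology.continuous_of_linearMap (conj K R).toLinearMap

end Topology

end KTensor

/-! ## Hermitian matrices and the unitary group `G = U(η)` -/

section Group

variable (K : Type*) [Field K] [NumberField K] [IsCMField K] (n : ℕ)
  (R : Type*) [CommRing R] [Algebra (RealField K) R]

/-- `Her_n(K ⊗_E R)`: the additive group of hermitian `n × n` matrices over `K ⊗_E R`. -/
def Her : Type _ := selfAdjoint (Matrix (Fin n) (Fin n) (KTensor K R))

instance : AddCommGroup (Her K n R) :=
  inferInstanceAs (AddCommGroup (selfAdjoint (Matrix (Fin n) (Fin n) (KTensor K R))))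

variable {K n R}

/-- The matrix underlying an element of `Her_n(K ⊗_E R)`. -/
def Her.mat (m : Her K n R) : Matrix (Fin n) (Fin n) (KTensor K R) := m.1

theorem Her.star_mat (m : Her K n R) : star m.mat = m.mat := m.2

/-- The action `m ↦ g m ᵗḡ` of `g ∈ GL_n(K ⊗_E R)` on hermitian matrices. -/
def Her.act (g : GL (Fin n) (KTensor K R)) (m : Her K n R) : Her K n R :=
  ⟨g.1 * m.mat * star g.1, by
    simp only [selfAdjoint.mem_iff, star_mul, star_star, m.star_mat, mul_assoc]⟩

/-- The image in `Her_n(K ⊗_E S)` of a hermitian matrix over `K ⊗_E R`. -/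
def Her.map {S : Type*} [CommRing S] [Algebra (RealField K) S] (φ : R →ₐ[RealField K] S)
    (m : Her K n R) : Her K n S :=
  ⟨m.mat.map (KTensor.map K φ), by
    rw [selfAdjoint.mem_iff]
    ext i j
    have h := congrFun (congrFun m.star_mat i) j
    simp only [star_apply, Matrix.map_apply] at h ⊢
    rw [← KTensor.map_star, h]⟩

variable (R) in
/-- The image in `Her_n(K ⊗_E R)` of a hermitian matrix over `K`. -/
def Her.ofField (β : selfAdjoint (Matrix (Fin n) (Fin n) K)) : Her K n R :=
  ⟨β.1.map (KTensor.ofField K R), by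
    rw [selfAdjoint.mem_iff]
    ext i j
    have h := congrFun (congrFun β.2 i) j
    simp only [star_apply, Matrix.map_apply] at h ⊢
    rw [← KTensor.ofField_star, h]⟩

variable (n) in
/-- The matrix `η = (0 -1; 1 0)`. -/
def eta (A : Type*) [CommRing A] : Matrix (Fin n ⊕ Fin n) (Fin n ⊕ Fin n) A :=
  fromBlocks 0 (-1) 1 0

variable (K n R) in
/-- `G(R) = {g ∈ GL_{2n}(K ⊗_E R) | g η ᵗḡ = η}`. -/
def U : Subgroup (GL (Fin n ⊕ Fin n) (KTensor K R)) where
  carrier := {g | g.1 * eta n (KTensor K R) * star g.1 = eta n (KTensor K R)}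
  one_mem' := by simp
  mul_mem' {a b} ha hb := by
    simp only [Set.mem_ofPred_eq, Units.val_mul, star_mul] at ha hb ⊢
    calc a.1 * b.1 * eta n (KTensor K R) * (star b.1 * star a.1)
        = a.1 * (b.1 * eta n (KTensor K R) * star b.1) * star a.1 := by simp only [mul_assoc]
      _ = _ := by rw [hb, ha]
  inv_mem' {a} ha := by
    simp only [Set.mem_ofPred_eq] at ha ⊢
    have h1 : (a⁻¹).1 * a.1 = 1 := a.inv_val
    have h2 : star a.1 * star (a⁻¹).1 = 1 := by rw [← star_mul, h1, star_one]
    calc (a⁻¹).1 * eta n (KTensor K R) * star (a⁻¹).1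
        = (a⁻¹).1 * (a.1 * eta n (KTensor K R) * star a.1) * star (a⁻¹).1 := by rw [ha]
      _ = ((a⁻¹).1 * a.1) * eta n (KTensor K R) * (star a.1 * star (a⁻¹).1) := by
          simp only [mul_assoc]
      _ = _ := by rw [h1, h2, one_mul, mul_one]

/-- The element `η` of `G(R)`. -/
def weyl : U K n R :=
  ⟨⟨eta n _, fromBlocks 0 1 (-1) 0, by simp [eta, fromBlocks_multiply],
    by simp [eta, fromBlocks_multiply]⟩, by
    change eta n _ * eta n _ * star (eta n _) = eta n (KTensor K R)
    simp [eta, fromBlocks_multiply, star_eq_conjTranspose, fromBlocks_conjTranspose]⟩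

/-- The element `(1 m; 0 1)` of the unipotent radical `N(R)`, for a hermitian matrix `m`. -/
def unip (m : Her K n R) : U K n R :=
  ⟨⟨fromBlocks 1 m.mat 0 1, fromBlocks 1 (-m.mat) 0 1, by simp [fromBlocks_multiply],
    by simp [fromBlocks_multiply]⟩, by
    change fromBlocks 1 m.mat 0 1 * eta n _ * star (fromBlocks 1 m.mat 0 1) = eta n (KTensor K R)
    have h : (m.mat)ᴴ = m.mat := m.star_mat
    simp [eta, fromBlocks_multiply, star_eq_conjTranspose, fromBlocks_conjTranspose, h]⟩

/-- The element `m(h) = diag(ᵗh̄⁻¹, h)` of the Levi subgroup `M(R)`. -/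
def levi (h : GL (Fin n) (KTensor K R)) : U K n R :=
  ⟨⟨fromBlocks (star h⁻¹).1 0 0 h.1, fromBlocks (star h).1 0 0 (h⁻¹).1,
    by
      rw [fromBlocks_multiply]
      simp only [mul_zero, zero_mul, add_zero, zero_add, ← Units.val_mul, ← star_mul]
      simp,
    by
      rw [fromBlocks_multiply]
      simp only [mul_zero, zero_mul, add_zero, zero_add, ← Units.val_mul, ← star_mul]
      simp⟩, by
    change fromBlocks (star h⁻¹).1 0 0 h.1 * eta n _ * star (fromBlocks (star h⁻¹).1 0 0 h.1)
      = eta n (KTensor K R)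
    have h1 : (star (h⁻¹).1 : Matrix (Fin n) (Fin n) (KTensor K R)) * star h.1 = 1 := by
      rw [← star_mul]; simp
    have h2 : h.1 * (h⁻¹).1 = 1 := h.val_inv
    rw [star_eq_conjTranspose, fromBlocks_conjTranspose, eta, fromBlocks_multiply,
      fromBlocks_multiply]
    simp only [mul_zero, zero_mul, add_zero, zero_add, star_zero, neg_zero, mul_neg, neg_mul,
      mul_one, Units.coe_star, ← star_eq_conjTranspose, star_star, h1, h2]⟩

/-- The homomorphism `G(R) → G(S)` induced by `R → S`. -/
def U.map {S : Type*} [CommRing S] [Algebra (RealField K) S] (φ : R →ₐ[RealField K] S)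
    (g : U K n R) : U K n S :=
  ⟨Matrix.GeneralLinearGroup.map (KTensor.map K φ) g.1, by
    have h : g.1.1 * eta n (KTensor K R) * star g.1.1 = eta n (KTensor K R) := g.2
    have h1 : (eta n (KTensor K R)).map (KTensor.map K φ) = eta n (KTensor K S) := by
      simp [eta, fromBlocks_map, Matrix.map_neg]
    have h2 : (star g.1.1).map (KTensor.map K φ) = star (g.1.1.map (KTensor.map K φ)) := by
      ext i j
      simp only [star_apply, Matrix.map_apply, KTensor.map_star]
    have h3 := congrArg (fun M => M.map (KTensor.map K φ)) h
    simp only [Matrix.map_mul, h1, h2] at h3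
    exact h3⟩

end Group

/-! ## Local theory -/

section HerTopology

variable (K : Type*) [Field K] [NumberField K] [IsCMField K] (n : ℕ)
  (R : Type*) [CommRing R] [Algebra (RealField K) R] [TopologicalSpace R] [IsTopologicalRing R]

instance : TopologicalSpace (Her K n R) :=
  inferInstanceAs (TopologicalSpace (selfAdjoint (Matrix (Fin n) (Fin n) (KTensor K R))))

instance : IsTopologicalAddGroup (Her K n R) :=
  inferInstanceAs (IsTopologicalAddGroup (selfAdjoint (Matrix (Fin n) (Fin n) (KTensor K R))))

instance [T2Space R] [LocallyCompactSpace R] : LocallyCompactSpace (Her K n R) := by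
  have h1 : LocallyCompactSpace (Matrix (Fin n) (Fin n) (KTensor K R)) :=
    inferInstanceAs (LocallyCompactSpace (Fin n → Fin n → KTensor K R))
  have h2 : IsClosed {m : Matrix (Fin n) (Fin n) (KTensor K R) | star m = m} :=
    isClosed_eq continuous_star continuous_id
  exact h2.isClosedEmbedding_subtypeVal.locallyCompactSpace

instance : MeasurableSpace (Her K n R) := borel _

instance : BorelSpace (Her K n R) := ⟨rfl⟩

/-- The Haar measure on `Her_n(K ⊗_E R)` for which the set `L` has volume `c`. -/
def haarNormalized [T2Space R] [LocallyCompactSpace R] (L : Set (Her K n R)) (c : ℝ≥0∞) :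
    Measure (Her K n R) :=
  (c / Measure.addHaar L) • Measure.addHaar

end HerTopology

section Local

variable {K : Type*} [Field K] [NumberField K] [IsCMField K] {n : ℕ}
  {F : Type*} [CommRing F] [Algebra (RealField K) F]

/-- For a completion `F = E_v` with absolute value `|·|_v = abv`, the absolute value
`|a|_v = |a ā|_v ^ (1/2)` on `K ⊗_E E_v`. -/
def localAbs (abv : F → ℝ) (a : KTensor K F) : ℝ :=
  Real.sqrt (abv (KTensor.descend K F (a * star a)))

/-- Membership in the representation of `G(E_v)` induced from the character
`χ_v |·|_v ^ (-2s)` of `P(E_v) = M(E_v) N(E_v)`, where `m(a) ∈ M(E_v)` is identified with `a`. -/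
def IsLocalSection (abv : F → ℝ) (χ : (KTensor K F)ˣ →* Circle) (s : ℂ) (f : U K n F → ℂ) : Prop :=
  ∀ (a : GL (Fin n) (KTensor K F)) (b : Her K n F) (g : U K n F),
    f (levi a * unip b * g) =
      χ (GeneralLinearGroup.det a) * (localAbs abv a.1.det : ℂ) ^ (-2 * s) * f g

/-- The integrand `f_v(η n(m) m(h)) e_v(-tr(β m))` of a local Fourier coefficient. -/
def localIntegrand (e : F → ℂ) (f : U K n F → ℂ) (β : Her K n F) (h : GL (Fin n) (KTensor K F))
    (m : Her K n F) : ℂ :=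
  f (weyl * unip m * levi h) * e (-KTensor.descend K F (β.mat * m.mat).trace)

end Local

/-! ## Local compactness of the completions at finite places -/

section Compactness

open HeightOneSpectrum

variable {E : Type*} [Field E] [NumberField E] (v : HeightOneSpectrum (𝓞 E))

theorem exists_sub_lt (x : v.adicCompletion E) (hx : Valued.v x ≤ 1) :
    ∃ a : 𝓞 E, Valued.v (x - algebraMap (𝓞 E) (v.adicCompletion E) a) < 1 := by
  have hopen : IsOpen {y : v.adicCompletion E | Valued.v (x - y) < 1} := by
    have h1 : {y : v.adicCompletion E | Valued.v (x - y) < 1} = {y | ‖x - y‖ < 1} := by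
      ext y
      exact (Valued.toNormedField.norm_lt_one_iff (L := v.adicCompletion E) (Γ₀ := WithZero (Multiplicative ℤ))).symm
    rw [h1]
    exact isOpen_lt (by fun_prop) continuous_const
  obtain ⟨k, hk⟩ := (v.denseRange_algebraMap E).exists_mem_open hopen ⟨x, by simp⟩
  have hk1 : v.valuation E k ≤ 1 := by
    have h3 : Valued.v (algebraMap E (v.adicCompletion E) k) ≤ 1 := by
      have := Valuation.map_sub (Valued.v : Valuation (v.adicCompletion E) _) x
        (x - algebraMap E _ k)
      rw [sub_sub_cancel] at this
      exact this.trans (max_le hx (le_of_lt hk))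
    rw [← valuedAdicCompletion_eq_valuation']
    exact h3
  obtain ⟨a, ha⟩ := exists_valuation_sub_lt_of_integer v hk1 1
  refine ⟨a, ?_⟩
  have h4 : Valued.v (algebraMap E (v.adicCompletion E) (algebraMap (𝓞 E) E a - k)) < 1 :=
    (valuedAdicCompletion_eq_valuation' v (algebraMap (𝓞 E) E a - k)).trans_lt (by simpa using ha)
  rw [map_sub, ← IsScalarTower.algebraMap_apply] at h4
  have h5 : x - algebraMap (𝓞 E) (v.adicCompletion E) a = (x - algebraMap E _ k) -
      (algebraMap (𝓞 E) (v.adicCompletion E) a - algebraMap E _ k) := by ring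
  rw [h5]
  exact (Valuation.map_sub _ _ _).trans_lt (max_lt hk h4)

theorem finite_residueField : Finite (Valued.ResidueField (v.adicCompletion E)) := by
  have : Finite (𝓞 E ⧸ v.asIdeal) := Ideal.finiteQuotientOfFreeOfNeBot v.asIdeal v.ne_bot
  let g : 𝓞 E →+* Valued.ResidueField (v.adicCompletion E) :=
    (IsLocalRing.residue (Valued.integer (v.adicCompletion E))).comp
      (algebraMap (𝓞 E) (v.adicCompletionIntegers E))
  have key : ∀ x : Valued.integer (v.adicCompletion E), Valued.v x.1 < 1 →
      IsLocalRing.residue _ x = 0 := by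
    intro x hx
    rw [IsLocalRing.residue_eq_zero_iff]
    exact (Valued.v : Valuation (v.adicCompletion E) _).mem_maximalIdeal_iff.mpr hx
  have hg : ∀ a ∈ v.asIdeal, g a = 0 := by
    intro a ha
    refine key _ ?_
    change Valued.v (algebraMap (𝓞 E) (v.adicCompletion E) a) < 1
    refine (valuedAdicCompletion_eq_valuation v a).trans_lt ?_
    exact (v.valuation_lt_one_iff_mem a).mpr ha
  have hs : Function.Surjective (Ideal.Quotient.lift v.asIdeal g hg) := by
    intro y
    obtain ⟨x, rfl⟩ := IsLocalRing.residue_surjective y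
    obtain ⟨a, ha⟩ := exists_sub_lt v x.1 x.2
    refine ⟨Ideal.Quotient.mk _ a, ?_⟩
    rw [Ideal.Quotient.lift_mk]
    symm
    rw [← sub_eq_zero]
    exact (map_sub (IsLocalRing.residue (Valued.integer (v.adicCompletion E))) x _).symm.trans
      (key _ ha)
  exact Finite.of_surjective _ hs

instance : LocallyCompactSpace (v.adicCompletion E) := by
  have h1 : IsDiscreteValuationRing (Valued.integer (v.adicCompletion E)) :=
    inferInstanceAs (IsDiscreteValuationRing (v.adicCompletionIntegers E))
  have h2 : CompleteSpace (Valued.integer (v.adicCompletion E)) :=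
    (Valued.isClosed_integer (v.adicCompletion E)).completeSpace_coe
  have h : CompactSpace (Valued.integer (v.adicCompletion E)) :=
    Valued.integer.compactSpace_iff_completeSpace_and_isDiscreteValuationRing_and_finite_residueField.mpr
      ⟨h2, h1, finite_residueField v⟩
  have := Valued.integer.properSpace_iff_compactSpace_integer.mpr h
  infer_instance

end Compactness

/-! ## The places of `E` -/

section Places

variable (K : Type*) [Field K] [NumberField K]

/-- The infinite places of `E`. -/
abbrev InfPlace : Type _ := InfinitePlace (RealField K)

/-- The finite places of `E`. -/
abbrev FinPlace : Type _ := HeightOneSpectrum (𝓞 (RealField K))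

/-- The adele ring of `E`. -/
abbrev Adele : Type _ := AdeleRing (𝓞 (RealField K)) (RealField K)

variable {K}

/-- The completion of `E` at a finite place. -/
abbrev FinPlace.Completion (v : FinPlace K) : Type _ := v.adicCompletion (RealField K)

/-- The ring of integers of the completion of `E` at a finite place. -/
abbrev FinPlace.Integers (v : FinPlace K) : ValuationSubring v.Completion :=
  v.adicCompletionIntegers (RealField K)

/-- The archimedean character `e_v(x) = exp(2 π i x)` of `E_v = ℝ`. -/
def infChar (v : InfPlace K) (x : v.Completion) : ℂ :=
  Complex.exp (2 * Real.pi * Complex.I * InfinitePlace.Completion.extensionEmbedding v x)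

/-- The closure of the prime field `ℚ` in `E_v`, which is `ℚ_q` for the prime `q` below `v`. -/
def primeClosure (v : FinPlace K) : Subfield v.Completion :=
  (⊥ : Subfield v.Completion).topologicalClosure

/-- The trace of `E_v` over `ℚ_q`. -/
def localTrace (v : FinPlace K) (x : v.Completion) : v.Completion :=
  (Algebra.trace (primeClosure v) v.Completion x : primeClosure v)

/-- The nonarchimedean character `e_v(x) = exp(-2 π i y)` of `E_v`, where `y ∈ ℚ` has
`q`-power denominator and `Tr(x) - y` is in `ℤ_q`. -/
def finChar (v : FinPlace K) (x : v.Completion) : ℂ :=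
  Complex.exp (-2 * Real.pi * Complex.I * ((Classical.epsilon fun y : ℚ =>
    (∃ k : ℕ, y.den ∣ Ideal.absNorm v.asIdeal ^ k) ∧
      ‖localTrace v x - (y : v.Completion)‖ ≤ 1 : ℚ) : ℂ))

/-- The projection `𝔸_E → E_v` for an infinite place. -/
def infProj (v : InfPlace K) : Adele K →ₐ[RealField K] v.Completion where
  toFun a := a.1 v
  map_one' := rfl
  map_mul' _ _ := rfl
  map_zero' := rfl
  map_add' _ _ := rfl
  commutes' _ := rfl

/-- The projection `𝔸_E → E_v` for a finite place. -/
def finProj (v : FinPlace K) : Adele K →ₐ[RealField K] v.Completion where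
  toFun a := a.2 v
  map_one' := rfl
  map_mul' _ _ := rfl
  map_zero' := rfl
  map_add' _ _ := rfl
  commutes' _ := rfl

open scoped Classical in
/-- The inclusion `E_v → 𝔸_E` for an infinite place (zero at the other places). -/
def infIncl (v : InfPlace K) : v.Completion →ₗ[RealField K] Adele K where
  toFun x := ((Pi.single v x : (w : InfPlace K) → w.Completion), 0)
  map_add' x y := by
    refine Prod.ext (funext fun w => ?_) (add_zero _).symm
    exact congrFun (Pi.single_add v x y) w
  map_smul' c x := by
    refine Prod.ext (funext fun w => ?_) (smul_zero c).symm
    exact congrFun (Pi.single_smul v c x) w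

open scoped Classical in
/-- The inclusion `E_v → 𝔸_E` for a finite place (zero at the other places). -/
def finIncl (v : FinPlace K) : v.Completion →ₗ[RealField K] Adele K where
  toFun x := (0, ⟨Pi.single v x, by
    filter_upwards [(Set.finite_singleton v).compl_mem_cofinite] with w hw
    rw [Pi.single_eq_of_ne (show w ≠ v from hw)]
    exact zero_mem _⟩)
  map_add' x y := by
    refine Prod.ext (add_zero _).symm (FiniteAdeleRing.ext _ fun w => ?_)
    exact congrFun (Pi.single_add v x y) w
  map_smul' c x := by
    refine Prod.ext (smul_zero c).symm (FiniteAdeleRing.ext _ fun w => ?_)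
    exact (congrFun (Pi.single_smul v c x) w).trans (Algebra.smul_def c _)

open scoped Classical in
theorem infIncl_mul (v : InfPlace K) (x y : v.Completion) :
    infIncl v (x * y) = infIncl v x * infIncl v y := by
  refine Prod.ext (funext fun w => ?_) (mul_zero _).symm
  exact congrFun (Pi.single_mul v x y) w

open scoped Classical in
theorem finIncl_mul (v : FinPlace K) (x y : v.Completion) :
    finIncl v (x * y) = finIncl v x * finIncl v y := by
  refine Prod.ext (mul_zero _).symm (FiniteAdeleRing.ext _ fun w => ?_)
  exact congrFun (Pi.single_mul v x y) w

section UnitIncl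

variable {R S : Type*} [CommRing R] [Algebra (RealField K) R] [CommRing S]
  [Algebra (RealField K) S] (ι : R →ₗ[RealField K] S)

/-- The additive map `K ⊗_E R → K ⊗_E S` induced by an `E`-linear map `R → S`. -/
def tensorIncl : KTensor K R →+ KTensor K S :=
  (ι.rTensor K : R ⊗[RealField K] K →ₗ[RealField K] S ⊗[RealField K] K).toAddMonoidHom

theorem tensorIncl_mul (hι : ∀ x y, ι (x * y) = ι x * ι y) (x y : KTensor K R) :
    tensorIncl ι (x * y) = tensorIncl ι x * tensorIncl ι y := by
  have hj : ∀ x y : R ⊗[RealField K] K,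
      ι.rTensor K (x * y) = ι.rTensor K x * ι.rTensor K y := by
    intro x y
    induction x using TensorProduct.induction_on with
    | zero => simp
    | add a b ha hb => simp only [add_mul, map_add, ha, hb]
    | tmul a b =>
      induction y using TensorProduct.induction_on with
      | zero => simp
      | add c d hc hd => simp only [mul_add, map_add, hc, hd]
      | tmul c d => simp [hι]
  exact hj x y

/-- For a multiplicative `E`-linear map `ι : R → S` (such as `E_v → 𝔸_E`), the homomorphism
`x ↦ 1 + ι(x - 1)` from `(K ⊗_E R)ˣ` to `(K ⊗_E S)ˣ`. -/
def unitIncl (hι : ∀ x y, ι (x * y) = ι x * ι y) : (KTensor K R)ˣ →* (KTensor K S)ˣ :=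
  Units.map
    { toFun := fun x => 1 + tensorIncl ι (x - 1)
      map_one' := by rw [sub_self, map_zero, add_zero]
      map_mul' := fun x y => by
        have h : x * y - 1 = (x - 1) * (y - 1) + (x - 1) + (y - 1) := by ring
        rw [h, map_add, map_add, tensorIncl_mul ι hι]
        ring }

end UnitIncl

/-- The inclusion `(K ⊗_E E_v)ˣ → 𝔸_Kˣ` for an infinite place `v` of `E`. -/
def infUnit (v : InfPlace K) : (KTensor K v.Completion)ˣ →* (KTensor K (Adele K))ˣ :=
  unitIncl (infIncl v) (infIncl_mul v)

/-- The inclusion `(K ⊗_E E_v)ˣ → 𝔸_Kˣ` for a finite place `v` of `E`. -/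
def finUnit (v : FinPlace K) : (KTensor K v.Completion)ˣ →* (KTensor K (Adele K))ˣ :=
  unitIncl (finIncl v) (finIncl_mul v)

/-- The adelic norm `|a|_E = ∏_v |a_v|_v` on the ideles of the totally real field `E`. -/
def adelicNorm (a : Adele K) : ℝ :=
  (∏ v : InfPlace K, ‖infProj v a‖) * ∏ᶠ v : FinPlace K, ‖finProj v a‖

/-- The subring `O_K ⊗ O_{E_v}` of `K ⊗_E E_v`. -/
def integers (v : FinPlace K) : Subring (KTensor K v.Completion) :=
  Subring.closure
    (algebraMap v.Completion (KTensor K v.Completion) '' (v.Integers : Set v.Completion) ∪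
      Set.range fun b : 𝓞 K => KTensor.ofField K v.Completion (b : K))

end Places

/-! ## Hecke characters, Siegel sections and Fourier coefficients -/

section Global

variable (K : Type*) [Field K] [NumberField K] [IsCMField K]

/-- A unitary Hecke character of `K`: a continuous character of `𝔸_Kˣ = (K ⊗_E 𝔸_E)ˣ` with values
in the unit circle that is trivial on `Kˣ`. -/
structure UnitaryHeckeCharacter where
  /-- the underlying homomorphism -/
  toHom : (KTensor K (Adele K))ˣ →* Circle
  continuous_toHom : Continuous toHom
  map_field : ∀ a : Kˣ, toHom (Units.map (KTensor.ofField K (Adele K)).toMonoidHom a) = 1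

variable {K}

/-- A factorizable Siegel section `f = ⊗_v f_v` in the representation of `G(𝔸_E)` induced from the
character `χ |·|_K ^ (-s)` of `P(𝔸_E)`: local sections `f_v`, of which almost all take the value
`1` on `G(O_{E_v})`. -/
structure FactorizableSection (χ : UnitaryHeckeCharacter K) (s : ℂ) (n : ℕ) where
  /-- the components at the infinite places -/
  inf : ∀ v : InfPlace K, U K n v.Completion → ℂ
  /-- the components at the finite places -/
  fin : ∀ v : FinPlace K, U K n v.Completion → ℂ
  inf_mem : ∀ v, IsLocalSection norm (χ.toHom.comp (infUnit v)) s (inf v)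
  fin_mem : ∀ v, IsLocalSection norm (χ.toHom.comp (finUnit v)) s (fin v)
  spherical : ∀ᶠ v : FinPlace K in cofinite, ∀ g : U K n v.Completion,
    (∀ i j, g.1.1 i j ∈ integers v) → fin v g = 1

/-- The function `f(g) = ∏_v f_v(g_v)` on `G(𝔸_E)`. -/
def FactorizableSection.toFun {χ : UnitaryHeckeCharacter K} {s : ℂ} {n : ℕ}
    (f : FactorizableSection χ s n) (g : U K n (Adele K)) : ℂ :=
  (∏ v, f.inf v (U.map (infProj v) g)) * ∏' v, f.fin v (U.map (finProj v) g)

/-- The Haar measure on `Her_n(K ⊗_E E_v)` for an infinite place `v` that is given by the volume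
form `⋀_j dx_jj ∧ ⋀_{j<k} (2⁻¹ dx_jk ∧ dx̄_jk)`, that is, by Lebesgue measure in the coordinates
`x_jj`, `Re x_jk`, `Im x_jk` (`j < k`). The matrices with all entries of absolute value at most
`1` have volume `2 ^ n π ^ (n (n - 1) / 2)`. -/
def infMeasure (n : ℕ) (v : InfPlace K) : Measure (Her K n v.Completion) :=
  haarNormalized K n v.Completion {m | ∀ i j, localAbs norm (m.mat i j) ≤ 1}
    (ENNReal.ofReal (2 ^ n * Real.pi ^ (n * (n - 1) / 2)))

/-- The Haar measure on `Her_n(K ⊗_E E_v)` for a finite place `v` for which `Her_n(O_K ⊗ O_{E_v})`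
has volume `1`. -/
def finMeasure (n : ℕ) (v : FinPlace K) : Measure (Her K n v.Completion) :=
  haarNormalized K n v.Completion {m | ∀ i j, m.mat i j ∈ integers v} 1

variable (K) in
/-- The constant `C(n, K) = 2 ^ (n(n-1)[E:ℚ]/2) |D_E| ^ (-n/2) |D_K| ^ (-n(n-1)/4)`. -/
def constC (n : ℕ) : ℝ :=
  2 ^ (n * (n - 1) * (Module.finrank ℚ (RealField K) : ℝ) / 2) *
    |(NumberField.discr (RealField K) : ℝ)| ^ (-(n : ℝ) / 2) *
    |(NumberField.discr K : ℝ)| ^ (-(n : ℝ) * (n - 1) / 4)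

namespace FactorizableSection

variable {χ : UnitaryHeckeCharacter K} {s : ℂ} {n : ℕ} (f : FactorizableSection χ s n)
  (β : Her K n (Adele K)) (h : GL (Fin n) (KTensor K (Adele K)))

/-- The integrand of the local Fourier coefficient at an infinite place. -/
def infIntegrand (v : InfPlace K) : Her K n v.Completion → ℂ :=
  localIntegrand (infChar v) (f.inf v) (β.map (infProj v))
    (GeneralLinearGroup.map (KTensor.map K (infProj v)) h)

/-- The integrand of the local Fourier coefficient at a finite place. -/
def finIntegrand (v : FinPlace K) : Her K n v.Completion → ℂ :=
  localIntegrand (finChar v) (f.fin v) (β.map (finProj v))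
    (GeneralLinearGroup.map (KTensor.map K (finProj v)) h)

/-- The local Fourier coefficient `c_v(β_v, h_v; f)` at an infinite place. -/
def infCoeff (v : InfPlace K) : ℂ := ∫ m, f.infIntegrand β h v m ∂(infMeasure n v)

/-- The local Fourier coefficient `c_v(β_v, h_v; f)` at a finite place. -/
def finCoeff (v : FinPlace K) : ℂ := ∫ m, f.finIntegrand β h v m ∂(finMeasure n v)

/-- The Fourier coefficient `c(β, h; f) = C(n, K) ∏_v c_v(β_v, h_v; f)`. -/
def coeff : ℂ :=
  constC K n * ((∏ v : InfPlace K, f.infCoeff β h v) * ∏' v : FinPlace K, f.finCoeff β h v)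

/-- Convergence of the expression that defines `c(β, h; f)`: all the local integrals converge
absolutely, and so does their product. -/
def CoeffConverges : Prop :=
  (∀ v, Integrable (f.infIntegrand β h v) (infMeasure n v)) ∧
  (∀ v, Integrable (f.finIntegrand β h v) (finMeasure n v)) ∧
  Multipliable fun v : FinPlace K => f.finCoeff β h v

end FactorizableSection

end Global

end SiegelEisenstein

end

/-! Write `k` for the conjugate transpose of `h⁻¹`, and `N` for the norm from `K ⊗_E R` to `R`, so
that `N b = b b̄`. Moving `m(h)` to the left through `n(x)` and then through `η` gives `η n(x) m(h)
= m(k) η n(ᵗh̄ x h)`. At each place the transformation law of `f_v` therefore extracts `χ_v(det k)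
|N det k|_v ^ (-s)`. The substitution `x' = ᵗh̄ x h` leaves the additive character unchanged once
`β` is replaced by `h⁻¹ β k`, because the trace is cyclic, and its Jacobian contributes `|N det k|_v
^ n`. Since `N det k` is the determinant of `ᵗh̄⁻¹ h⁻¹`, these are the local factors of the claim.

Two points carry the weight. The Jacobian (`Her.map_act_addHaar`) needs that Haar measure on `E_v`
is scaled by the normalized absolute value, that a linear map then scales volumes by the absolute
value of its determinant, and that the action on hermitian matrices has determinant `± N(det g) ^
n`; the sign is irrelevant, so computing the square suffices.

Globally (`UnitaryHeckeCharacter.hasProd`), the product of the local values of `χ` must converge to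
`χ`: an idele is the limit of the finite products of its local components, and `χ` is continuous.
The absolute values are 1 at almost all places. As the product of the factors is nonzero,
convergence transfers in both directions. Analytic continuation is the identity theorem, since `t ^
(n - s)` is entire in `s` for `t > 0`. -/

noncomputable section

namespace SiegelEisenstein

/-! ### Linear maps and Haar measure over a normed field -/

section LinearModulus

open Measure LinearMap

variable {F : Type*} [NormedField F] [MeasurableSpace F]

/-- A measure on a normed field is scaled by the norm if multiplication by `a ≠ 0` multiplies
volumes by `‖a‖`. -/
def ScaledByNorm (μ : Measure F) : Prop :=
  ∀ a : F, a ≠ 0 → μ.map (a * ·) = ENNReal.ofReal ‖a‖⁻¹ • μ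

variable [BorelSpace F] {μ : Measure F} {ι : Type*} [Fintype ι] [DecidableEq ι]

theorem ScaledByNorm.preimage (hμ : ScaledByNorm μ) {a : F} (ha : a ≠ 0) (s : Set F) :
    ENNReal.ofReal ‖a‖ * μ ((a * ·) ⁻¹' s) = μ s := by
  have h : μ.map (a * ·) s = μ ((a * ·) ⁻¹' s) :=
    (Homeomorph.mulLeft₀ a ha).toMeasurableEquiv.map_apply s
  rw [← h, hμ a ha, Measure.smul_apply, smul_eq_mul, ← mul_assoc,
    ← ENNReal.ofReal_mul (norm_nonneg _), mul_inv_cancel₀ (norm_ne_zero_iff.mpr ha),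
    ENNReal.ofReal_one, one_mul]

variable [SecondCountableTopology F]

/-- Boxes determine a product measure, and the preimage of a box under a diagonal matrix is again a
box, so the claim splits into one-dimensional ones. -/
theorem ScaledByNorm.smul_map_diagonal_pi [SigmaFinite μ] (hμ : ScaledByNorm μ) {D : ι → F}
    (h : det (diagonal D) ≠ 0) :
    ENNReal.ofReal ‖det (diagonal D)‖ •
      Measure.map (toLin' (diagonal D)) (Measure.pi fun _ : ι => μ) = Measure.pi fun _ => μ := by
  refine (Measure.pi_eq fun s hs => ?_).symm
  simp only [det_diagonal, Measure.coe_smul, smul_eq_mul, Pi.smul_apply]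
  rw [Measure.map_apply _ (MeasurableSet.univ_pi hs)]
  swap; · exact Continuous.measurable (LinearMap.continuous_on_pi _)
  have : (toLin' (diagonal D) ⁻¹' Set.pi Set.univ fun i : ι => s i) =
      Set.pi Set.univ fun i : ι => (D i * ·) ⁻¹' s i := by
    ext f
    simp only [LinearMap.coe_proj, smul_eq_mul, LinearMap.smul_apply, Set.mem_univ_pi,
      Set.mem_preimage, LinearMap.pi_apply, diagonal_toLin']
  have B : ∀ i, ENNReal.ofReal ‖D i‖ * μ ((D i * ·) ⁻¹' s i) = μ (s i) := fun i => by
    refine hμ.preimage ?_ _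
    simp only [det_diagonal, Ne] at h
    exact Finset.prod_ne_zero_iff.1 h i (Finset.mem_univ i)
  rw [this, pi_pi, norm_prod, ENNReal.ofReal_prod_of_nonneg fun i _ => norm_nonneg (D i),
    ← Finset.prod_mul_distrib]
  simp only [B]

/-- A transvection changes a single coordinate, translating it by an amount that depends only on
another one. Integrating over that coordinate first, translation invariance gives the claim. -/
theorem measurePreserving_transvectionStruct_pi [SigmaFinite μ] [IsAddLeftInvariant μ]
    (t : TransvectionStruct ι F) :
    MeasurePreserving (toLin' t.toMatrix) (Measure.pi fun _ : ι => μ) (Measure.pi fun _ => μ) := by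
  have ht : Measurable (toLin' t.toMatrix) :=
    (LinearMap.continuous_on_pi (toLin' t.toMatrix)).measurable
  refine ⟨ht, ?_⟩
  refine (pi_eq fun s hs ↦ ?_).symm
  have h2s : MeasurableSet (Set.univ.pi s) := .pi Set.countable_univ fun i _ ↦ hs i
  simp_rw [← pi_pi, ← lintegral_indicator_one h2s]
  rw [lintegral_map (measurable_one.indicator h2s) ht]
  refine lintegral_eq_of_lmarginal_eq {t.i} ((measurable_one.indicator h2s).comp ht)
    (measurable_one.indicator h2s) ?_
  simp_rw [lmarginal_singleton]
  ext x
  cases t with | mk t_i t_j t_hij t_c =>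
  simp [Matrix.transvection, single_mulVec, t_hij.symm, ← Function.update_add,
    lintegral_add_right_eq_self fun xᵢ ↦
      Set.indicator (Set.univ.pi s) 1 (Function.update x t_i xᵢ)]

/-- Over a field whose Haar measure is scaled by the norm, an invertible matrix rescales the
product measure through the norm of its determinant. -/
theorem ScaledByNorm.map_matrix_pi [SigmaFinite μ] [IsAddLeftInvariant μ] (hμ : ScaledByNorm μ)
    {M : Matrix ι ι F} (hM : det M ≠ 0) :
    Measure.map (toLin' M) (Measure.pi fun _ : ι => μ) =
      ENNReal.ofReal ‖det M‖⁻¹ • Measure.pi fun _ => μ := by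
  -- An invertible matrix is a product of transvections and a diagonal matrix, and both sides are
  -- multiplicative in `M`.
  apply diagonal_transvection_induction_of_det_ne_zero _ M hM
  · intro D hD
    conv_rhs => rw [← hμ.smul_map_diagonal_pi hD]
    rw [smul_smul, ← ENNReal.ofReal_mul (inv_nonneg.mpr (norm_nonneg _)),
      inv_mul_cancel₀ (norm_ne_zero_iff.mpr hD), ENNReal.ofReal_one, one_smul]
  · intro t
    rw [Matrix.TransvectionStruct.det, norm_one, inv_one, ENNReal.ofReal_one, one_smul,
      (measurePreserving_transvectionStruct_pi _).map_eq]
  · intro A B _ _ IHA IHB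
    rw [toLin'_mul, det_mul, LinearMap.coe_comp, ← Measure.map_map, IHB, Measure.map_smul, IHA,
      smul_smul, ← ENNReal.ofReal_mul (inv_nonneg.mpr (norm_nonneg _)), norm_mul, mul_comm,
      mul_inv]
    · exact (LinearMap.continuous_on_pi _).measurable
    · exact (LinearMap.continuous_on_pi _).measurable

end LinearModulus

section LinearModulus

open Measure

variable {F : Type*} [NontriviallyNormedField F] [CompleteSpace F] [LocallyCompactSpace F]
  [SecondCountableTopology F] [MeasurableSpace F] [BorelSpace F] {μ : Measure F}

/-- Over a field whose Haar measure is scaled by the norm, an invertible endomorphism of a finite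
dimensional space rescales Haar measures through the norm of its determinant. -/
theorem ScaledByNorm.map_linearMap [IsAddHaarMeasure μ] (hμ : ScaledByNorm μ) {V : Type*}
    [AddCommGroup V] [Module F V] [FiniteDimensional F V] [TopologicalSpace V]
    [IsTopologicalAddGroup V] [ContinuousSMul F V] [T2Space V] [MeasurableSpace V] [BorelSpace V]
    (ν : Measure V) [IsAddHaarMeasure ν] {f : V →ₗ[F] V} (hf : LinearMap.det f ≠ 0) :
    Measure.map f ν = ENNReal.ofReal ‖LinearMap.det f‖⁻¹ • ν := by
  let ι := Fin (Module.finrank F V)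
  let e : V ≃ₗ[F] ι → F := LinearEquiv.ofFinrankEq V (ι → F) (by simp [ι])
  obtain ⟨g, hg⟩ : ∃ g, g = (e : V →ₗ[F] ι → F).comp (f.comp (e.symm : (ι → F) →ₗ[F] V)) :=
    ⟨_, rfl⟩
  have gdet : LinearMap.det g = LinearMap.det f := by rw [hg]; exact LinearMap.det_conj f e
  rw [← gdet] at hf ⊢
  have fg : f = (e.symm : (ι → F) →ₗ[F] V).comp (g.comp (e : V →ₗ[F] ι → F)) := by
    ext x
    simp only [hg, LinearEquiv.coe_coe, Function.comp_apply, LinearMap.coe_comp,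
      LinearEquiv.symm_apply_apply]
  simp only [fg, LinearEquiv.coe_coe, LinearMap.coe_comp]
  have Ce : Continuous e := (e : V →ₗ[F] ι → F).continuous_of_finiteDimensional
  have Cg : Continuous g := LinearMap.continuous_of_finiteDimensional g
  have Cesymm : Continuous e.symm := (e.symm : (ι → F) →ₗ[F] V).continuous_of_finiteDimensional
  rw [← map_map Cesymm.measurable (Cg.comp Ce).measurable, ← map_map Cg.measurable Ce.measurable]
  have : IsAddHaarMeasure (map e ν) := (e : V ≃+ (ι → F)).isAddHaarMeasure_map ν Ce Cesymm
  have ecomp : e.symm ∘ e = id := by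
    ext x; simp only [id, Function.comp_apply, LinearEquiv.symm_apply_apply]
  have key : map g (map e ν) = ENNReal.ofReal ‖LinearMap.det g‖⁻¹ • map e ν := by
    -- By uniqueness of Haar measure the transported measure is a multiple of the product measure,
    -- and the constant commutes with the pushforward.
    rw [isAddLeftInvariant_eq_smul (map e ν) (Measure.pi fun _ : ι => μ), Measure.map_smul]
    have h1 : LinearMap.det g = Matrix.det (LinearMap.toMatrix' g) := by
      simp only [LinearMap.det_toMatrix']
    have h2 := hμ.map_matrix_pi (M := LinearMap.toMatrix' g) (h1 ▸ hf)
    rw [toLin'_toMatrix', ← h1] at h2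
    rw [h2, smul_comm]
  rw [key, Measure.map_smul, map_map Cesymm.measurable Ce.measurable, ecomp, Measure.map_id]

end LinearModulus

/-! ### Detecting the scaling factor of Haar measure -/

section ScaledByNorm

open Measure

variable {F : Type*} [NormedField F] [MeasurableSpace F] [BorelSpace F]

theorem isAddHaarMeasure_map_mul_left (μ : Measure F) [IsAddHaarMeasure μ] {a : F} (ha : a ≠ 0) :
    IsAddHaarMeasure (μ.map (a * ·)) := by
  let e : F ≃+ F := AddEquiv.mk (Equiv.mulLeft₀ a ha) (mul_add a)
  exact e.isAddHaarMeasure_map μ (continuous_const_mul a) (continuous_const_mul a⁻¹)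

variable [LocallyCompactSpace F] [SecondCountableTopology F] {μ : Measure F} [IsAddHaarMeasure μ]

/-- The factor by which multiplication by `a` scales a Haar measure can be read off from the
measure of a single set. -/
theorem map_mul_left_of_measure {a : F} (ha : a ≠ 0) {X : Set F} (h0 : μ X ≠ 0) (h1 : μ X ≠ ∞)
    (h : μ ((a⁻¹ * ·) ⁻¹' X) = ENNReal.ofReal ‖a‖ * μ X) :
    μ.map (a * ·) = ENNReal.ofReal ‖a‖⁻¹ • μ := by
  have hH : IsAddHaarMeasure (μ.map (a * ·)) :=
    isAddHaarMeasure_map_mul_left μ ha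
  have hc := isAddLeftInvariant_eq_smul (μ.map (a * ·)) μ
  set c := addHaarScalarFactor (μ.map (a * ·)) μ
  -- The preimage of `X` under `a⁻¹` is `a X`, whose measure under the pushforward by `a` is `μ X`.
  -- Comparison with `h` gives `c ‖a‖ = 1`.
  have h2 : μ.map (a * ·) ((a⁻¹ * ·) ⁻¹' X) = μ X := by
    have := (Homeomorph.mulLeft₀ a ha).toMeasurableEquiv.map_apply (μ := μ) ((a⁻¹ * ·) ⁻¹' X)
    refine this.trans ?_
    congr 1
    ext x
    change a⁻¹ * (a * x) ∈ X ↔ _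
    rw [inv_mul_cancel_left₀ ha]
  rw [hc, Measure.smul_apply, h, ENNReal.smul_def, smul_eq_mul, ← mul_assoc] at h2
  have h3 : (c : ℝ≥0∞) * ENNReal.ofReal ‖a‖ = 1 := by
    rw [← ENNReal.mul_left_inj h0 h1, h2, one_mul]
  rw [hc, ENNReal.ofReal_inv_of_pos (norm_pos_iff.mpr ha), ← ENNReal.eq_inv_of_mul_eq_one_left h3]
  rfl

/-- The units `a` for which multiplication by `a` scales the measure `μ` by `‖a‖`. -/
def normScalingSubgroup (μ : Measure F) : Subgroup Fˣ where
  carrier := {a | μ.map ((a : F) * ·) = ENNReal.ofReal ‖(a : F)‖⁻¹ • μ}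
  one_mem' := by simp
  mul_mem' {a b} ha hb := by
    simp only [Set.mem_ofPred_eq, Units.val_mul] at ha hb ⊢
    have h : (fun x : F => (a : F) * b * x) = ((a : F) * ·) ∘ ((b : F) * ·) := by
      ext x; exact mul_assoc _ _ _
    rw [h, ← Measure.map_map (measurable_const_mul _) (measurable_const_mul _), hb,
      Measure.map_smul, ha, smul_smul, ← ENNReal.ofReal_mul (inv_nonneg.mpr (norm_nonneg _)),
      norm_mul, mul_comm, mul_inv]
  inv_mem' {a} ha := by
    simp only [Set.mem_ofPred_eq] at ha ⊢
    have h : (((a⁻¹ : Fˣ) : F) * ·) ∘ ((a : F) * ·) = id := by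
      ext x; exact a.inv_mul_cancel_left x
    have h1 : Measure.map (((a⁻¹ : Fˣ) : F) * ·) (Measure.map ((a : F) * ·) μ) = μ := by
      rw [Measure.map_map (measurable_const_mul _) (measurable_const_mul _), h, Measure.map_id]
    rw [ha, Measure.map_smul] at h1
    conv_rhs => rw [← h1]
    rw [smul_smul, ← ENNReal.ofReal_mul (inv_nonneg.mpr (norm_nonneg _)), ← mul_inv, ← norm_mul,
      Units.inv_mul, norm_one, inv_one, ENNReal.ofReal_one, one_smul]

end ScaledByNorm

/-! ### Haar measure at the infinite places -/

section Real

open Measure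

/-- Lebesgue measure is transported along the isometry. The closed unit ball serves as test set,
since its dilate by `a` is the ball of radius `‖a‖`. -/
theorem exists_scaledByNorm_of_isometry_real {F : Type*} [NormedField F] [MeasurableSpace F]
    [BorelSpace F] (e : F ≃+* ℝ) (he : ∀ x, ‖e x‖ = ‖x‖) :
    ∃ μ : Measure F, IsAddHaarMeasure μ ∧ ScaledByNorm μ := by
  have hi : Isometry e := AddMonoidHomClass.isometry_of_norm e he
  let E : F ≃ᵢ ℝ := ⟨e.toEquiv, hi⟩
  have : LocallyCompactSpace F := E.toHomeomorph.isClosedEmbedding.locallyCompactSpace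
  have : SecondCountableTopology F := E.toHomeomorph.secondCountableTopology
  have hH : IsAddHaarMeasure (Measure.map e.symm volume) :=
    e.symm.toAddEquiv.isAddHaarMeasure_map volume E.symm.continuous E.continuous
  have hball : ∀ r : ℝ, Measure.map e.symm volume (Metric.closedBall (0 : F) r)
      = ENNReal.ofReal (2 * r) := by
    intro r
    have h1 : Measure.map e.symm volume (Metric.closedBall (0 : F) r) =
        volume (e.symm ⁻¹' Metric.closedBall (0 : F) r) :=
      E.symm.toHomeomorph.toMeasurableEquiv.map_apply _
    have h2 : e.symm ⁻¹' Metric.closedBall (0 : F) r = Metric.closedBall (0 : ℝ) r := by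
      ext x
      rw [Set.mem_preimage, mem_closedBall_zero_iff, mem_closedBall_zero_iff, ← he (e.symm x),
        RingEquiv.apply_symm_apply]
    rw [h1, h2, Real.volume_closedBall]
  refine ⟨Measure.map e.symm volume, hH, fun a ha => ?_⟩
  refine map_mul_left_of_measure ha (X := Metric.closedBall 0 1) ?_ ?_ ?_
  · rw [hball]; norm_num
  · rw [hball]; exact ENNReal.ofReal_ne_top
  · have h3 : (a⁻¹ * ·) ⁻¹' Metric.closedBall (0 : F) 1 = Metric.closedBall (0 : F) ‖a‖ := by
      ext x
      rw [Set.mem_preimage, mem_closedBall_zero_iff, mem_closedBall_zero_iff, norm_mul, norm_inv,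
        inv_mul_le_iff₀ (norm_pos_iff.mpr ha), mul_one]
    rw [h3, hball, hball, ← ENNReal.ofReal_mul (norm_nonneg _)]
    congr 1
    ring

/-- Total reality of `E` is essential: at a complex place volumes would scale by the square of the
norm. -/
theorem exists_scaledByNorm_inf {K : Type*} [Field K] [NumberField K] (v : InfPlace K)
    [MeasurableSpace v.Completion] [BorelSpace v.Completion] :
    ∃ μ : Measure v.Completion, IsAddHaarMeasure μ ∧ ScaledByNorm μ := by
  have hv : v.IsReal := IsTotallyReal.isReal v
  refine exists_scaledByNorm_of_isometry_real
    (InfinitePlace.Completion.ringEquivRealOfIsReal hv) fun x => ?_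
  have h := (InfinitePlace.Completion.isometry_extensionEmbeddingOfIsReal hv).dist_eq x 0
  rw [map_zero, dist_zero_right, dist_zero_right] at h
  exact h

/-- The completion of the totally real field `E` at an infinite place, as a nontrivially normed
field. -/
abbrev nontriviallyNormedFieldCompletion {K : Type*} [Field K] [NumberField K] (v : InfPlace K) :
    NontriviallyNormedField v.Completion where
  toNormedField := inferInstance
  non_trivial := by
    refine ⟨2, ?_⟩
    have h := (InfinitePlace.Completion.isometry_extensionEmbedding v).dist_eq 2 0
    rw [map_zero, dist_zero_right, dist_zero_right, map_ofNat] at h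
    rw [← h]
    norm_num

/-- Properness supplies the second countability that the product measures require. -/
instance {K : Type*} [Field K] [NumberField K] (v : InfPlace K) : ProperSpace v.Completion :=
  letI := nontriviallyNormedFieldCompletion v
  ProperSpace.of_nontriviallyNormedField_of_weaklyLocallyCompactSpace _

end Real

/-! ### Haar measure at the finite places -/

section Finite

open Measure HeightOneSpectrum

variable {E : Type*} [Field E] [NumberField E] (v : HeightOneSpectrum (𝓞 E))

theorem adicCompletion_norm_le_one_iff (x : v.adicCompletion E) : ‖x‖ ≤ 1 ↔ Valued.v x ≤ 1 :=
  Valued.toNormedField.norm_le_one_iff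

theorem adicCompletion_norm_lt_one_iff (x : v.adicCompletion E) : ‖x‖ < 1 ↔ Valued.v x < 1 :=
  Valued.toNormedField.norm_lt_one_iff

/-- Together with the converse below, this identifies the group of nonzero norms with the powers of
`N v`. -/
theorem exists_norm_eq_absNorm_zpow (k : ℤ) :
    ∃ x : (v.adicCompletion E)ˣ, ‖(x : v.adicCompletion E)‖ = (Ideal.absNorm v.asIdeal : ℝ) ^ k := by
  obtain ⟨x, hx⟩ := v.valuedAdicCompletion_surjective E (WithZero.exp k)
  have h0 : x ≠ 0 := by
    rintro rfl
    rw [map_zero] at hx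
    exact WithZero.exp_ne_zero hx.symm
  refine ⟨Units.mk0 x h0, ?_⟩
  rw [Units.val_mk0, FinitePlace.norm_def, hx,
    WithZeroMulInt.toNNReal_neg_apply _ WithZero.exp_ne_zero]
  have h1 : (WithZero.unzero (WithZero.exp_ne_zero (a := k))).toAdd = k := rfl
  simp [h1]

theorem exists_norm_eq_absNorm_zpow' (x : (v.adicCompletion E)ˣ) :
    ∃ k : ℤ, ‖(x : v.adicCompletion E)‖ = (Ideal.absNorm v.asIdeal : ℝ) ^ k := by
  have h : Valued.v (x : v.adicCompletion E) ≠ 0 := by simp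
  refine ⟨(WithZero.unzero h).toAdd, ?_⟩
  rw [FinitePlace.norm_def, WithZeroMulInt.toNNReal_neg_apply _ h]
  simp

/-- The completion of a number field at a finite place, as a nontrivially normed field. -/
abbrev nontriviallyNormedFieldAdicCompletion : NontriviallyNormedField (v.adicCompletion E) where
  toNormedField := inferInstance
  non_trivial := by
    obtain ⟨x, hx⟩ := exists_norm_eq_absNorm_zpow v 1
    refine ⟨x, ?_⟩
    rw [hx, zpow_one]
    exact_mod_cast one_lt_absNorm v

instance : ProperSpace (v.adicCompletion E) :=
  letI := nontriviallyNormedFieldAdicCompletion v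
  ProperSpace.of_nontriviallyNormedField_of_weaklyLocallyCompactSpace _

theorem norm_algebraMap_lt_one_iff (a : 𝓞 E) :
    ‖algebraMap (𝓞 E) (v.adicCompletion E) a‖ < 1 ↔ a ∈ v.asIdeal := by
  rw [adicCompletion_norm_lt_one_iff, ← v.valuation_lt_one_iff_mem (K := E)]
  exact iff_of_eq (congrArg (· < 1) (valuedAdicCompletion_eq_valuation (K := E) v a))

/-- The residue field of `E_v` has `N v` elements, in terms of Haar measure. -/
theorem absNorm_mul_measure_ball [MeasurableSpace (v.adicCompletion E)]
    [BorelSpace (v.adicCompletion E)] (μ : Measure (v.adicCompletion E)) [IsAddHaarMeasure μ] :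
    (Ideal.absNorm v.asIdeal : ℝ≥0∞) * μ (Metric.ball 0 1) = μ (Metric.closedBall 0 1) := by
  have hfin : Finite (𝓞 E ⧸ v.asIdeal) := Ideal.finiteQuotientOfFreeOfNeBot v.asIdeal v.ne_bot
  have : Fintype (𝓞 E ⧸ v.asIdeal) := Fintype.ofFinite _
  let t : 𝓞 E ⧸ v.asIdeal → v.adicCompletion E := fun r => algebraMap (𝓞 E) _ (Quotient.out r)
  have hna : IsUltrametricDist (v.adicCompletion E) := inferInstance
  have hle : ∀ a : 𝓞 E, ‖algebraMap (𝓞 E) (v.adicCompletion E) a‖ ≤ 1 := by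
    intro a
    rw [adicCompletion_norm_le_one_iff]
    exact ((valuedAdicCompletion_eq_valuation (K := E) v a).trans_le (v.valuation_le_one (K := E) a) :)
  -- The integers of `E_v` are the union of the residue classes of representatives of `𝓞 E ⧸ v`,
  -- because `𝓞 E` surjects onto the residue field.
  have hU : Metric.closedBall (0 : v.adicCompletion E) 1 = ⋃ r, Metric.ball (t r) 1 := by
    ext x
    rw [mem_closedBall_zero_iff, Set.mem_iUnion]
    constructor
    · intro hx
      obtain ⟨a, ha⟩ := exists_sub_lt v x ((adicCompletion_norm_le_one_iff v x).mp hx)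
      rw [← adicCompletion_norm_lt_one_iff] at ha
      refine ⟨Ideal.Quotient.mk _ a, ?_⟩
      rw [mem_ball_iff_norm]
      have h1 : a - Quotient.out (Ideal.Quotient.mk v.asIdeal a) ∈ v.asIdeal := by
        rw [← Ideal.Quotient.eq]
        exact (Ideal.Quotient.mk_out _).symm
      rw [← norm_algebraMap_lt_one_iff, map_sub] at h1
      have h2 := IsUltrametricDist.norm_add_le_max
        (x - algebraMap (𝓞 E) (v.adicCompletion E) a) _ |>.trans_lt (max_lt ha h1)
      rwa [sub_add_sub_cancel] at h2
    · rintro ⟨r, hr⟩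
      rw [mem_ball_iff_norm] at hr
      have := IsUltrametricDist.norm_add_le_max (x - t r) (t r)
      rw [sub_add_cancel] at this
      exact this.trans (max_le hr.le (hle _))
  -- If two such balls meet, the ultrametric inequality puts their centres at distance less than 1,
  -- so the centres are congruent modulo `v`.
  have hd : Pairwise (Function.onFun Disjoint fun r => Metric.ball (t r) 1) := by
    intro r r' hrr
    rw [Function.onFun, Set.disjoint_left]
    intro x hx hx'
    apply hrr
    rw [mem_ball_iff_norm] at hx hx'
    rw [norm_sub_rev] at hx
    have h2 := (IsUltrametricDist.norm_add_le_max (t r - x) (x - t r')).trans_lt (max_lt hx hx')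
    rw [sub_add_sub_cancel, ← map_sub, norm_algebraMap_lt_one_iff, ← Ideal.Quotient.eq,
      Ideal.Quotient.mk_out, Ideal.Quotient.mk_out] at h2
    exact h2
  rw [hU, measure_iUnion hd fun r => measurableSet_ball]
  have hc : ∀ x : v.adicCompletion E, μ (Metric.ball x 1) = μ (Metric.ball 0 1) := fun x => by
    rw [← measure_preimage_add μ x (Metric.ball x 1), preimage_add_ball, sub_self]
  simp_rw [hc]
  rw [tsum_fintype, Finset.sum_const, Finset.card_univ, nsmul_eq_mul, Ideal.absNorm_apply,
    Submodule.cardQuot_apply, Nat.card_eq_fintype_card]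

/-- The elements that scale measure correctly form a group. It contains the elements of norm 1,
which preserve the closed unit ball, and a uniformizer, by the count of residue classes; these
generate the multiplicative group. -/
theorem exists_scaledByNorm_fin [MeasurableSpace (v.adicCompletion E)]
    [BorelSpace (v.adicCompletion E)] :
    ∃ μ : Measure (v.adicCompletion E), IsAddHaarMeasure μ ∧ ScaledByNorm μ := by
  let μ : Measure (v.adicCompletion E) := addHaar
  have h0 : μ (Metric.closedBall 0 1) ≠ 0 :=
    (Metric.measure_closedBall_pos μ 0 one_pos).ne'
  have h1 : μ (Metric.closedBall 0 1) ≠ ∞ := (isCompact_closedBall 0 1).measure_ne_top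
  refine ⟨μ, inferInstance, fun a ha => ?_⟩
  suffices h : Units.mk0 a ha ∈ normScalingSubgroup μ from h
  obtain ⟨π, hπ⟩ := exists_norm_eq_absNorm_zpow v (-1)
  have hq : (1 : ℝ) < Ideal.absNorm v.asIdeal := by exact_mod_cast one_lt_absNorm v
  have hpre : ∀ b : (v.adicCompletion E)ˣ, ((b⁻¹ : v.adicCompletion E) * ·) ⁻¹'
      Metric.closedBall (0 : v.adicCompletion E) 1 = Metric.closedBall 0 ‖(b : v.adicCompletion E)‖ := by
    intro b
    ext x
    rw [Set.mem_preimage, mem_closedBall_zero_iff, mem_closedBall_zero_iff, norm_mul, norm_inv,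
      inv_mul_le_iff₀ (norm_pos_iff.mpr b.ne_zero), mul_one]
  have hπmem : π ∈ normScalingSubgroup μ := by
    refine map_mul_left_of_measure π.ne_zero h0 h1 ?_
    -- The norm takes discrete values: the largest one below 1 is `(N v)⁻¹`, the norm of `π`.
    have hball : Metric.closedBall (0 : v.adicCompletion E) ‖(π : v.adicCompletion E)‖
        = Metric.ball 0 1 := by
      ext x
      rw [mem_closedBall_zero_iff, mem_ball_zero_iff, hπ]
      rcases eq_or_ne x 0 with rfl | hx
      · rw [norm_zero]
        exact iff_of_true (by positivity) one_pos
      · obtain ⟨k, hk⟩ := exists_norm_eq_absNorm_zpow' v (Units.mk0 x hx)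
        rw [Units.val_mk0] at hk
        rw [hk, zpow_le_zpow_iff_right₀ hq, zpow_lt_one_iff_right₀ hq]
        omega
    rw [hpre, hball, ← absNorm_mul_measure_ball, hπ, ← mul_assoc, _root_.zpow_neg_one,
      ENNReal.ofReal_inv_of_pos (by linarith), ENNReal.ofReal_natCast,
      ENNReal.inv_mul_cancel (by exact_mod_cast (by linarith : (Ideal.absNorm v.asIdeal : ℝ) ≠ 0))
        (ENNReal.natCast_ne_top _), one_mul]
  have hunit : ∀ u : (v.adicCompletion E)ˣ, ‖(u : v.adicCompletion E)‖ = 1 →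
      u ∈ normScalingSubgroup μ := by
    intro u hu
    refine map_mul_left_of_measure u.ne_zero h0 h1 ?_
    rw [hpre, hu, ENNReal.ofReal_one, one_mul]
  obtain ⟨k, hk⟩ := exists_norm_eq_absNorm_zpow' v (Units.mk0 a ha)
  -- As `‖a‖ = (N v) ^ k` and `‖π‖ = (N v)⁻¹`, this product has norm 1.
  have hu : Units.mk0 a ha * π ^ k ∈ normScalingSubgroup μ := by
    refine hunit _ ?_
    rw [Units.val_mul, norm_mul, hk, Units.val_zpow_eq_zpow_val, norm_zpow, hπ, ← _root_.zpow_mul,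
      ← zpow_add₀ (by linarith), neg_one_mul, add_neg_cancel, zpow_zero]
  exact (Subgroup.mul_mem_cancel_right _ (Subgroup.zpow_mem _ hπmem k)).mp hu

end Finite

/-! ## The determinant of the action on hermitian matrices -/

section MatrixDet

/-- Right multiplication by `g` acts on each of the `n` rows separately, through the transpose of
`g`. -/
theorem det_mulRight_matrix {S : Type*} [CommRing S] {n : ℕ} (g : Matrix (Fin n) (Fin n) S) :
    LinearMap.det (LinearMap.mulRight S g) = g.det ^ n := by
  have h : LinearMap.mulRight S g
      = (LinearMap.pi fun i => (Matrix.toLin' gᵀ).comp (LinearMap.proj i) :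
        (Fin n → Fin n → S) →ₗ[S] (Fin n → Fin n → S)) := by
    refine LinearMap.ext fun M => funext fun i => funext fun j => ?_
    change (M * g) i j = Matrix.toLin' gᵀ (M i) j
    rw [Matrix.toLin'_apply, Matrix.mulVec_transpose]
    rfl
  refine (congrArg LinearMap.det h).trans ((LinearMap.det_pi fun _ => Matrix.toLin' gᵀ).trans ?_)
  simp

/-- Transposition conjugates left multiplication by `g` into right multiplication by `gᵀ`. -/
theorem det_mulLeft_matrix {S : Type*} [CommRing S] {n : ℕ} (g : Matrix (Fin n) (Fin n) S) :
    LinearMap.det (LinearMap.mulLeft S g) = g.det ^ n := by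
  rw [← g.det_transpose, ← det_mulRight_matrix, ← LinearMap.det_conj (LinearMap.mulLeft S g)
    (Matrix.transposeLinearEquiv (Fin n) (Fin n) S S)]
  congr 1
  ext M : 1
  simp [Matrix.transpose_mul]

end MatrixDet

/-! ### The norm of `K ⊗_E R` over `R` -/

section Norm

variable {K : Type*} [Field K] [NumberField K] [IsCMField K]
  {R : Type*} [CommRing R] [Algebra (RealField K) R]

namespace KTensor

/-- The norm of `b ∈ K ⊗_E R` is `b b̄`. -/
theorem norm_eq_descend (b : KTensor K R) : Algebra.norm R b = descend K R (b * star b) := by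
  let e : Module.Basis (Fin 2) R (KTensor K R) := Algebra.TensorProduct.basis R
    (Module.finBasisOfFinrankEq (RealField K) K (Algebra.IsQuadraticExtension.finrank_eq_two _ _))
  -- For a 2 × 2 matrix, `2 det A = (tr A)² - tr A²`. With `tr x = x + x̄` the right side becomes `2
  -- b b̄`, and 2 is invertible.
  have h : 2 * Algebra.norm R b = Algebra.trace R (KTensor K R) b ^ 2
      - Algebra.trace R (KTensor K R) (b * b) := by
    rw [Algebra.norm_eq_matrix_det e, Algebra.trace_eq_matrix_trace e,
      Algebra.trace_eq_matrix_trace e, map_mul]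
    generalize Algebra.leftMulMatrix e b = A
    rw [Matrix.det_fin_two, Matrix.trace_fin_two, Matrix.trace_fin_two, Matrix.mul_apply,
      Matrix.mul_apply, Fin.sum_univ_two, Fin.sum_univ_two]
    ring
  have h2 : algebraMap R (KTensor K R) (2 * Algebra.norm R b)
      = algebraMap R (KTensor K R) 2 * (b * star b) := by
    rw [h, map_sub, map_pow, algebraMap_trace, algebraMap_trace, star_mul, map_ofNat]
    ring
  have h3 : algebraMap R (KTensor K R) (Algebra.norm R b) = b * star b := by
    have := congrArg (algebraMap R (KTensor K R) (algebraMap (RealField K) R (1 / 2)) * ·) h2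
    simp only [map_mul, ← mul_assoc] at this
    rwa [← map_mul, mul_comm _ (2 : R), two_mul_half K R, map_one, one_mul, one_mul] at this
  rw [← h3, descend_algebraMap]

theorem norm_star (b : KTensor K R) : Algebra.norm R (star b) = Algebra.norm R b := by
  rw [norm_eq_descend, norm_eq_descend, star_star, mul_comm]

theorem star_smul' (r : R) (x : KTensor K R) : star (r • x) = r • star x := map_smul (conj K R) r x

variable (K R) in
/-- There is a unit of `K ⊗_E R` whose conjugate is its negative. -/
theorem exists_star_eq_neg : ∃ d : (KTensor K R)ˣ, star (d : KTensor K R) = -d := by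
  obtain ⟨x, hx⟩ : ∃ x : K, IsCMField.complexConj K x ≠ x := by
    by_contra! h
    exact IsCMField.complexConj_ne_one K (AlgEquiv.ext h)
  let δ : K := x - IsCMField.complexConj K x
  have h0 : δ ≠ 0 := sub_ne_zero.mpr hx.symm
  refine ⟨Units.map (ofField K R).toMonoidHom (Units.mk0 δ h0), ?_⟩
  have h1 : star δ = -δ := by
    change IsCMField.complexConj K (x - IsCMField.complexConj K x) = _
    rw [map_sub, IsCMField.complexConj_apply_apply, neg_sub]
  change star (ofField K R δ) = -ofField K R δ
  rw [← ofField_star, h1, map_neg]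

end KTensor

end Norm

/-! ### Hermitian matrices as a module -/

section HerModule

theorem half_smul_add_self {K : Type*} [Field K] [CharZero K] {R : Type*} [CommRing R]
    [Algebra (RealField K) R] {M : Type*} [AddCommGroup M] [Module R M] (x : M) :
    algebraMap (RealField K) R (1 / 2) • (x + x) = x := by
  rw [← two_smul R x, smul_smul, mul_comm, KTensor.two_mul_half K R, one_smul]

variable {K : Type*} [Field K] [NumberField K] [IsCMField K] {n : ℕ}
  {R : Type*} [CommRing R] [Algebra (RealField K) R]

theorem star_smul_matrix (r : R) (M : Matrix (Fin n) (Fin n) (KTensor K R)) :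
    star (r • M) = r • star M := by
  ext i j
  exact KTensor.star_smul' r (M j i)

namespace Her

theorem mat_injective : Function.Injective (mat : Her K n R → _) := Subtype.val_injective

theorem act_mul (g h : GL (Fin n) (KTensor K R)) (m : Her K n R) :
    act (g * h) m = act g (act h m) := by
  apply mat_injective
  change (g * h).1 * m.mat * star (g * h).1 = g.1 * (h.1 * m.mat * star h.1) * star g.1
  rw [Units.val_mul, star_mul]
  simp only [mul_assoc]

theorem act_one (m : Her K n R) : act 1 m = m := by
  apply mat_injective
  change (1 : GL (Fin n) (KTensor K R)).1 * m.mat * star (1 : GL (Fin n) (KTensor K R)).1 = m.mat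
  simp

/-- The involution fixes `R`, so scaling by `R` preserves hermitian matrices; the action of `g`
thereby acquires a determinant over `R`. -/
instance : SMul R (Her K n R) where
  smul r m := ⟨r • m.mat, (star_smul_matrix r m.mat).trans (congrArg _ m.star_mat)⟩

/-- The additive inclusion of the hermitian matrices in all matrices. -/
def matHom : Her K n R →+ Matrix (Fin n) (Fin n) (KTensor K R) where
  toFun := mat
  map_zero' := rfl
  map_add' _ _ := rfl

instance : Module R (Her K n R) :=
  Function.Injective.module R matHom mat_injective fun _ _ => rfl

/-- The linear inclusion of the hermitian matrices in all matrices. -/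
def matLin : Her K n R →ₗ[R] Matrix (Fin n) (Fin n) (KTensor K R) where
  toFun := mat
  map_add' _ _ := rfl
  map_smul' _ _ := rfl

/-- The linear endomorphism `m ↦ g m ᵗḡ` of the space of hermitian matrices. -/
def actLin (g : GL (Fin n) (KTensor K R)) : Her K n R →ₗ[R] Her K n R where
  toFun := act g
  map_add' x y := by
    apply mat_injective
    change g.1 * (x.mat + y.mat) * star g.1 = g.1 * x.mat * star g.1 + g.1 * y.mat * star g.1
    rw [mul_add, add_mul]
  map_smul' r x := by
    apply mat_injective
    change g.1 * (r • x.mat) * star g.1 = r • (g.1 * x.mat * star g.1)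
    rw [mul_smul_comm, smul_mul_assoc]

/-- The decomposition of a matrix into a hermitian and a skew-hermitian one, which are identified
by multiplication by a unit `d` with `d̄ = -d`. -/
def prodEquiv (d : (KTensor K R)ˣ) (hd : star (d : KTensor K R) = -d) :
    (Her K n R × Her K n R) ≃ₗ[R] Matrix (Fin n) (Fin n) (KTensor K R) where
  toFun p := p.1.mat + (d : KTensor K R) • p.2.mat
  map_add' p q := by
    change (p.1.mat + q.1.mat) + (d : KTensor K R) • (p.2.mat + q.2.mat) = _
    rw [smul_add]
    abel
  map_smul' r p := by
    change r • p.1.mat + (d : KTensor K R) • r • p.2.mat = r • (p.1.mat + (d : KTensor K R) • p.2.mat)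
    rw [smul_add, smul_comm]
  -- `M` is half of `M + M*` plus half of `M - M*`. Dividing the second part by `d` makes it
  -- hermitian, since `d⁻¹` also changes sign under the involution.
  invFun M :=
    (⟨algebraMap (RealField K) R (1 / 2) • (M + star M), by
      rw [selfAdjoint.mem_iff, star_smul_matrix, star_add, star_star, add_comm]⟩,
    ⟨algebraMap (RealField K) R (1 / 2) • ((d⁻¹ : (KTensor K R)ˣ) : KTensor K R) • (M - star M), by
      have hd' : star ((d⁻¹ : (KTensor K R)ˣ) : KTensor K R) = -((d⁻¹ : (KTensor K R)ˣ) : KTensor K R) := by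
        have h : star d = -d := Units.ext hd
        rw [← Units.coe_star_inv, h, inv_neg, Units.val_neg]
      rw [selfAdjoint.mem_iff, star_smul_matrix, star_smul, hd', star_sub, star_star, neg_smul,
        ← smul_neg, neg_sub]⟩)
  left_inv p := by
    have h : star (p.1.mat + (d : KTensor K R) • p.2.mat)
        = p.1.mat - (d : KTensor K R) • p.2.mat := by
      rw [star_add, star_smul, hd, star_mat, star_mat, neg_smul, sub_eq_add_neg]
    refine Prod.ext (mat_injective ?_) (mat_injective ?_)
    · change algebraMap (RealField K) R (1 / 2) • (p.1.mat + (d : KTensor K R) • p.2.mat +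
        star (p.1.mat + (d : KTensor K R) • p.2.mat)) = p.1.mat
      rw [h, add_add_sub_cancel, half_smul_add_self]
    · change algebraMap (RealField K) R (1 / 2) • ((d⁻¹ : (KTensor K R)ˣ) : KTensor K R) •
        (p.1.mat + (d : KTensor K R) • p.2.mat - star (p.1.mat + (d : KTensor K R) • p.2.mat))
        = p.2.mat
      rw [h, add_sub_sub_cancel, ← smul_add, smul_smul, Units.inv_mul, one_smul, half_smul_add_self]
  right_inv M := by
    change algebraMap (RealField K) R (1 / 2) • (M + star M) + (d : KTensor K R) •
      algebraMap (RealField K) R (1 / 2) • ((d⁻¹ : (KTensor K R)ˣ) : KTensor K R) • (M - star M) = M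
    rw [smul_comm (d : KTensor K R), smul_smul (d : KTensor K R), Units.mul_inv, one_smul,
      ← smul_add, add_add_sub_cancel, half_smul_add_self]

end Her

end HerModule

section HerDet

/-- The determinant over `K ⊗_E R` is `det g ^ n * det h ^ n`; restriction of scalars to `R`
replaces it by its norm. -/
theorem det_mulLeft_comp_mulRight {K : Type*} [Field K] {n : ℕ}
    {R : Type*} [CommRing R] [Algebra (RealField K) R]
    (g h : Matrix (Fin n) (Fin n) (KTensor K R)) :
    LinearMap.det (LinearMap.mulLeft R g ∘ₗ LinearMap.mulRight R h)
      = Algebra.norm R g.det ^ n * Algebra.norm R h.det ^ n := by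
  have h1 : LinearMap.mulLeft R g ∘ₗ LinearMap.mulRight R h =
    (LinearMap.mulLeft (KTensor K R) g ∘ₗ LinearMap.mulRight (KTensor K R) h).restrictScalars R := rfl
  rw [h1, LinearMap.det_restrictScalars, LinearMap.det_comp, det_mulLeft_matrix,
    det_mulRight_matrix, map_mul, map_pow, map_pow]

theorem isUnit_norm_det {K : Type*} [Field K] {n : ℕ}
    {R : Type*} [CommRing R] [Algebra (RealField K) R]
    (g : GL (Fin n) (KTensor K R)) : IsUnit (Algebra.norm R g.1.det) :=
  ((Matrix.isUnit_iff_isUnit_det g.1).mp g.isUnit).map (Algebra.norm R)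

variable {K : Type*} [Field K] [NumberField K] [IsCMField K] {n : ℕ}

instance {F : Type*} [Field F] [Algebra (RealField K) F] : FiniteDimensional F (Her K n F) :=
  Module.Finite.of_injective Her.matLin Her.mat_injective

/-- The map `M ↦ g M ᵗḡ` on all matrices commutes with the scalar `d`, so under `prodEquiv` it is
two copies of the action on hermitian matrices. Its determinant is thus a square, and it equals
`N(det g) ^ n` times `N` of the conjugate of `det g` to the power `n`. -/
theorem Her.det_actLin_sq {F : Type*} [Field F] [Algebra (RealField K) F]
    (g : GL (Fin n) (KTensor K F)) :
    LinearMap.det (Her.actLin g) ^ 2 = Algebra.norm F g.1.det ^ (2 * n) := by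
  obtain ⟨d, hd⟩ := KTensor.exists_star_eq_neg K F
  have h1 : LinearMap.mulLeft F g.1 ∘ₗ LinearMap.mulRight F (star g.1) =
      (Her.prodEquiv d hd).toLinearMap ∘ₗ
        ((Her.actLin g).prodMap (Her.actLin g)) ∘ₗ (Her.prodEquiv d hd).symm.toLinearMap := by
    rw [← LinearMap.comp_assoc, LinearEquiv.eq_comp_toLinearMap_symm]
    refine LinearMap.ext fun p => ?_
    change g.1 * ((p.1.mat + (d : KTensor K F) • p.2.mat) * star g.1) =
      g.1 * p.1.mat * star g.1 + (d : KTensor K F) • (g.1 * p.2.mat * star g.1)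
    rw [add_mul, mul_add, smul_mul_assoc, mul_smul_comm, mul_assoc, mul_assoc]
  have h2 := det_mulLeft_comp_mulRight g.1 (star g.1)
  rw [h1, LinearMap.det_conj, LinearMap.det_prodMap, star_eq_conjTranspose, det_conjTranspose,
    KTensor.norm_star] at h2
  rw [sq, h2]
  ring

end HerDet

/-! ### Haar measure on hermitian matrices -/

section HerMeasure

open Measure

variable {K : Type*} [Field K] [NumberField K] [IsCMField K] {n : ℕ}

section

variable {R : Type*} [CommRing R] [Algebra (RealField K) R] [TopologicalSpace R]

theorem Her.continuous_mat : Continuous (Her.mat : Her K n R → _) := continuous_subtype_val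

variable [IsTopologicalRing R]

instance : ContinuousSMul R (Her K n R) where
  continuous_smul := Continuous.subtype_mk
    (continuous_fst.smul (Her.continuous_mat.comp continuous_snd)) _

instance [T2Space R] : T2Space (Her K n R) :=
  inferInstanceAs (T2Space (selfAdjoint (Matrix (Fin n) (Fin n) (KTensor K R))))

theorem Her.continuous_act (g : GL (Fin n) (KTensor K R)) : Continuous (Her.act g) :=
  Continuous.subtype_mk ((continuous_const.mul Her.continuous_mat).mul continuous_const) _

/-- The action of an element of `GL_n(K ⊗_E R)` as a homeomorphism of `Her_n(K ⊗_E R)`. -/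
def Her.actHomeomorph (g : GL (Fin n) (KTensor K R)) : Her K n R ≃ₜ Her K n R where
  toFun := Her.act g
  invFun := Her.act g⁻¹
  left_inv m := by rw [← Her.act_mul, inv_mul_cancel, Her.act_one]
  right_inv m := by rw [← Her.act_mul, mul_inv_cancel, Her.act_one]
  continuous_toFun := Her.continuous_act g
  continuous_invFun := Her.continuous_act g⁻¹

end

variable {F : Type*} [NontriviallyNormedField F] [CompleteSpace F] [LocallyCompactSpace F]
  [SecondCountableTopology F] [MeasurableSpace F] [BorelSpace F] [Algebra (RealField K) F]

/-- The action of `g` on hermitian matrices multiplies volumes by `|N(det g)| ^ n`. -/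
theorem Her.map_act_addHaar {μ : Measure F} [IsAddHaarMeasure μ] (hμ : ScaledByNorm μ)
    (g : GL (Fin n) (KTensor K F)) :
    Measure.map (Her.act g) (addHaar : Measure (Her K n F)) =
      ENNReal.ofReal (‖Algebra.norm F g.1.det‖⁻¹ ^ n) • addHaar := by
  have h1 := Her.det_actLin_sq g
  have h0 : LinearMap.det (Her.actLin g) ≠ 0 := by
    intro h
    rw [h, zero_pow two_ne_zero] at h1
    exact pow_ne_zero _ (isUnit_norm_det g).ne_zero h1.symm
  -- The sign left open by the square disappears in the norm.
  have h2 : ‖LinearMap.det (Her.actLin g)‖ = ‖Algebra.norm F g.1.det‖ ^ n := by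
    refine (pow_left_inj₀ (norm_nonneg _) (by positivity) two_ne_zero).mp ?_
    rw [← norm_pow, h1, norm_pow, pow_mul']
  have := hμ.map_linearMap (addHaar : Measure (Her K n F)) h0
  rw [h2, ← inv_pow] at this
  exact this

end HerMeasure

/-! ## The transformation of the local Fourier coefficients -/

section LocalAlgebra

variable {K : Type*} [Field K] [NumberField K] [IsCMField K] {n : ℕ}
  {R : Type*} [CommRing R] [Algebra (RealField K) R]

/-- Here `n(m) m(h) = m(h) n(ᵗh̄ m h)`, and conjugation by `η` turns `m(h)` into `m(ᵗh̄⁻¹)`. The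
trivial factors `unip 0` and `levi 1` give both sides the shape used in `IsLocalSection` and
`localIntegrand`. -/
theorem weyl_mul_unip_mul_levi (m : Her K n R) (h : GL (Fin n) (KTensor K R)) :
    weyl * unip m * levi h =
      levi (star h)⁻¹ * unip 0 * (weyl * unip (Her.act (star h) m) * levi 1) := by
  apply Subtype.ext
  apply Units.ext
  change fromBlocks 0 (-1) 1 0 * fromBlocks 1 m.mat 0 1 * fromBlocks (star h⁻¹).1 0 0 h.1 =
    fromBlocks (star ((star h)⁻¹)⁻¹).1 0 0 ((star h)⁻¹).1 *
      fromBlocks 1 (0 : Matrix (Fin n) (Fin n) (KTensor K R)) 0 1 *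
      (fromBlocks 0 (-1) 1 0 * fromBlocks 1 ((star h).1 * m.mat * star (star h).1) 0 1 *
        fromBlocks (star (1 : GL (Fin n) (KTensor K R))⁻¹).1 0 0 (1 : GL (Fin n) (KTensor K R)).1)
  have h1 : ((star h)⁻¹).1 * ((star h).1 * m.mat * h.1) = m.mat * h.1 := by
    rw [mul_assoc, ← mul_assoc, Units.inv_mul, one_mul]
  simp only [fromBlocks_multiply, inv_inv, star_star, inv_one, star_one, Units.val_one, mul_zero,
    zero_mul, add_zero, zero_add, mul_one, one_mul, neg_mul, mul_neg, Units.coe_star] at h1 ⊢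
  have h2 : ((star h)⁻¹).1 = star (h⁻¹).1 := by rw [← star_inv, Units.coe_star]
  rw [h1, h2, neg_zero, zero_add]

/-- By cyclicity of the trace, the additive character is unaffected by the change of variables. -/
theorem Her.trace_act (β m : Her K n R) (h : GL (Fin n) (KTensor K R)) :
    ((Her.act h⁻¹ β).mat * (Her.act (star h) m).mat).trace = (β.mat * m.mat).trace := by
  change ((h⁻¹).1 * β.mat * star (h⁻¹).1 * (star h.1 * m.mat * star (star h.1))).trace = _
  have h1 : star (h⁻¹).1 * star h.1 = 1 := by rw [← star_mul, Units.mul_inv, star_one]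
  have h2 : (h⁻¹).1 * β.mat * star (h⁻¹).1 * (star h.1 * m.mat * star (star h.1))
      = (h⁻¹).1 * (β.mat * ((star (h⁻¹).1 * star h.1) * m.mat) * h.1) := by
    rw [star_star]
    simp only [mul_assoc]
  rw [h2, h1, one_mul, Matrix.trace_mul_comm, mul_assoc, Units.mul_inv, mul_one]

/-- The local integrands for `h` and for `1`. -/
theorem localIntegrand_eq {abv : R → ℝ} {χ : (KTensor K R)ˣ →* Circle} {s : ℂ} {f : U K n R → ℂ}
    (hf : IsLocalSection abv χ s f) (e : R → ℂ) (β : Her K n R) (h : GL (Fin n) (KTensor K R))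
    (m : Her K n R) :
    localIntegrand e f β h m =
      χ (GeneralLinearGroup.det (star h)⁻¹) * (localAbs abv ((star h)⁻¹).1.det : ℂ) ^ (-2 * s) *
        localIntegrand e f (Her.act h⁻¹ β) 1 (Her.act (star h) m) := by
  rw [localIntegrand, localIntegrand, weyl_mul_unip_mul_levi, hf, Her.trace_act, mul_assoc]

/-- `h⁻¹` is the conjugate transpose of `ᵗh̄⁻¹`. This links the determinant in the final formula to
`localAbs` and to the norm. -/
theorem det_star_inv_mul_inv (h : GL (Fin n) (KTensor K R)) :
    (((star h)⁻¹).val * (h⁻¹).val).det = ((star h)⁻¹).1.det * star ((star h)⁻¹).1.det := by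
  have h1 : (h⁻¹).val = star ((star h)⁻¹).val := by
    rw [← Units.coe_star, ← star_inv, star_star]
  rw [det_mul, h1, star_eq_conjTranspose, det_conjTranspose]

theorem descend_det_star_inv_mul_inv (h : GL (Fin n) (KTensor K R)) :
    KTensor.descend K R (((star h)⁻¹).val * (h⁻¹).val).det
      = Algebra.norm R ((star h)⁻¹).1.det := by
  rw [det_star_inv_mul_inv, KTensor.norm_eq_descend]

theorem norm_det_star_mul (h : GL (Fin n) (KTensor K R)) :
    Algebra.norm R (star h).1.det * Algebra.norm R ((star h)⁻¹).1.det = 1 := by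
  rw [← map_mul, ← det_mul, Units.mul_inv, det_one, map_one]

end LocalAlgebra

theorem ofReal_cpow_ne_zero {t : ℝ} (ht : 0 < t) (z : ℂ) : (t : ℂ) ^ z ≠ 0 := by
  rw [Ne, Complex.cpow_eq_zero_iff, Complex.ofReal_eq_zero]
  exact fun h => ht.ne' h.1

/-- The square root is the one in `|a|_v = |a ā|_v ^ (1/2)`; it turns the exponent `-2s` of the
section into `-s`. -/
theorem sqrt_cpow_neg_two_mul {t : ℝ} (ht : 0 < t) (s : ℂ) :
    (Real.sqrt t : ℂ) ^ (-2 * s) = (t : ℂ) ^ (-s) := by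
  rw [Complex.cpow_def_of_ne_zero (by exact_mod_cast (Real.sqrt_pos.mpr ht).ne'),
    Complex.cpow_def_of_ne_zero (by exact_mod_cast ht.ne'), ← Complex.ofReal_log (Real.sqrt_nonneg t),
    ← Complex.ofReal_log ht.le, Real.log_sqrt ht.le]
  congr 1
  push_cast
  ring

/-! ### Change of variables in the local integrals -/

section LocalIntegral

open Measure

variable {K : Type*} [Field K] [NumberField K] [IsCMField K] {n : ℕ}
  {F : Type*} [NontriviallyNormedField F] [CompleteSpace F] [LocallyCompactSpace F]
  [SecondCountableTopology F] [MeasurableSpace F] [BorelSpace F] [Algebra (RealField K) F]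

/-- The factor `|N det ᵗh̄| ^ (-n)` is rewritten in terms of the inverse. It does not depend on the
normalization `L`, `c`, so finite and infinite places are treated alike. -/
theorem Her.map_act_haarNormalized {μ : Measure F} [IsAddHaarMeasure μ] (hμ : ScaledByNorm μ)
    (h : GL (Fin n) (KTensor K F)) (L : Set (Her K n F)) (c : ℝ≥0∞) :
    Measure.map (Her.act (star h)) (haarNormalized K n F L c) =
      ENNReal.ofReal (‖KTensor.descend K F (((star h)⁻¹).val * (h⁻¹).val).det‖ ^ n) •
        haarNormalized K n F L c := by
  have h1 : ‖Algebra.norm F (star h).1.det‖⁻¹ = ‖Algebra.norm F ((star h)⁻¹).1.det‖ := by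
    rw [← norm_inv, inv_eq_of_mul_eq_one_right (norm_det_star_mul h)]
  rw [haarNormalized, Measure.map_smul, Her.map_act_addHaar hμ, smul_comm,
    descend_det_star_inv_mul_inv, h1]

variable {χ : (KTensor K F)ˣ →* Circle} {s : ℂ} {f : U K n F → ℂ}

/-- The local Fourier coefficients for `(β, h)` and for `(h⁻¹ β ᵗh̄⁻¹, 1)`. -/
theorem localCoeff_eq {μ : Measure F} [IsAddHaarMeasure μ] (hμ : ScaledByNorm μ)
    (hf : IsLocalSection norm χ s f) (e : F → ℂ) (β : Her K n F) (h : GL (Fin n) (KTensor K F))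
    (L : Set (Her K n F)) (c : ℝ≥0∞) :
    (Integrable (localIntegrand e f β h) (haarNormalized K n F L c) ↔
      Integrable (localIntegrand e f (Her.act h⁻¹ β) 1) (haarNormalized K n F L c)) ∧
    ∫ m, localIntegrand e f β h m ∂(haarNormalized K n F L c) =
      χ (GeneralLinearGroup.det (star h)⁻¹) *
        (‖KTensor.descend K F (((star h)⁻¹).val * (h⁻¹).val).det‖ : ℂ) ^ ((n : ℂ) - s) *
        ∫ m, localIntegrand e f (Her.act h⁻¹ β) 1 m ∂(haarNormalized K n F L c) := by
  set t := ‖KTensor.descend K F (((star h)⁻¹).val * (h⁻¹).val).det‖ with ht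
  have ht0 : 0 < t := by
    rw [ht, descend_det_star_inv_mul_inv]
    exact norm_pos_iff.mpr (isUnit_norm_det _).ne_zero
  have ht1 : (t : ℂ) ≠ 0 := by exact_mod_cast ht0.ne'
  have hC : (localAbs norm ((star h)⁻¹).1.det : ℂ) ^ (-2 * s) = (t : ℂ) ^ (-s) := by
    rw [localAbs, ← det_star_inv_mul_inv, sqrt_cpow_neg_two_mul ht0]
  let A : Her K n F ≃ᵐ Her K n F := (Her.actHomeomorph (star h)).toMeasurableEquiv
  have hA : Measure.map A (haarNormalized K n F L c) =
      ENNReal.ofReal (t ^ n) • haarNormalized K n F L c := Her.map_act_haarNormalized hμ h L c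
  -- `C` is the contribution of the section. The remaining `t ^ n` comes from the measure.
  set C : ℂ := χ (GeneralLinearGroup.det (star h)⁻¹) * (t : ℂ) ^ (-s) with hCdef
  have hC0 : C ≠ 0 := mul_ne_zero (Circle.coe_ne_zero _) (ofReal_cpow_ne_zero ht0 _)
  have hI : localIntegrand e f β h = fun m => C * localIntegrand e f (Her.act h⁻¹ β) 1 (A m) := by
    ext m
    rw [localIntegrand_eq hf e β h m, hC]
    rfl
  constructor
  · have h1 := integrable_map_equiv A (μ := haarNormalized K n F L c)
      (localIntegrand e f (Her.act h⁻¹ β) 1)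
    rw [hA, integrable_smul_measure (ENNReal.ofReal_pos.mpr (pow_pos ht0 n)).ne' ENNReal.ofReal_ne_top] at h1
    rw [hI, integrable_const_mul_iff (isUnit_iff_ne_zero.mpr hC0), h1]
    rfl
  · rw [hI, integral_const_mul, ← integral_map_equiv A (localIntegrand e f (Her.act h⁻¹ β) 1), hA,
      integral_smul_measure, ENNReal.toReal_ofReal (pow_nonneg ht0.le n), sub_eq_add_neg,
      Complex.cpow_add _ _ ht1, Complex.cpow_natCast, Complex.real_smul, Complex.ofReal_pow, hCdef]
    ring

end LocalIntegral

/-! ## Compatibility with extension of scalars -/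

section BaseChange

theorem KTensor.map_algebraMap {K : Type*} [Field K] {R S : Type*} [CommRing R]
    [Algebra (RealField K) R] [CommRing S] [Algebra (RealField K) S] (φ : R →ₐ[RealField K] S)
    (r : R) :
    KTensor.map K φ (algebraMap R (KTensor K R) r) = algebraMap S (KTensor K S) (φ r) := by
  change Algebra.TensorProduct.map φ (AlgHom.id (RealField K) K) (r ⊗ₜ 1) = φ r ⊗ₜ 1
  simp

variable {K : Type*} [Field K] [NumberField K] [IsCMField K] {n : ℕ}
  {R S : Type*} [CommRing R] [Algebra (RealField K) R] [CommRing S] [Algebra (RealField K) S]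
  (φ : R →ₐ[RealField K] S)

/-- A fixed element comes from `R`, and the inclusion `R → K ⊗_E R` is natural in `R`. -/
theorem KTensor.descend_map {x : KTensor K R} (hx : star x = x) :
    KTensor.descend K S (KTensor.map K φ x) = φ (KTensor.descend K R x) := by
  conv_lhs => rw [← KTensor.algebraMap_descend x hx]
  rw [KTensor.map_algebraMap, KTensor.descend_algebraMap]

theorem GL_map_star (g : GL (Fin n) (KTensor K R)) :
    GeneralLinearGroup.map (KTensor.map K φ) (star g)
      = star (GeneralLinearGroup.map (KTensor.map K φ) g) := by
  apply Units.ext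
  ext i j
  exact KTensor.map_star φ (g.1 j i)

theorem Her.map_act (g : GL (Fin n) (KTensor K R)) (m : Her K n R) :
    (Her.act g m).map φ = Her.act (GeneralLinearGroup.map (KTensor.map K φ) g) (m.map φ) := by
  apply Her.mat_injective
  change (g.1 * m.mat * star g.1).map (KTensor.map K φ) =
    g.1.map (KTensor.map K φ) * m.mat.map (KTensor.map K φ) * star (g.1.map (KTensor.map K φ))
  have h : (star g.1).map (KTensor.map K φ) = star (g.1.map (KTensor.map K φ)) := by
    ext i j
    exact KTensor.map_star φ (g.1 j i)
  rw [Matrix.map_mul, Matrix.map_mul, h]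

theorem descend_det_map (h : GL (Fin n) (KTensor K R)) :
    KTensor.descend K S (((star (GeneralLinearGroup.map (KTensor.map K φ) h))⁻¹).val *
      ((GeneralLinearGroup.map (KTensor.map K φ) h)⁻¹).val).det =
      φ (KTensor.descend K R (((star h)⁻¹).val * (h⁻¹).val).det) := by
  rw [← KTensor.descend_map, ← GL_map_star, ← map_inv, ← map_inv]
  · congr 1
    rw [RingHom.map_det, RingHom.mapMatrix_apply, Matrix.map_mul]
    rfl
  · rw [det_star_inv_mul_inv, star_mul, star_star]

end BaseChange

/-! ## Decomposition of ideles into local components -/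

section Adele

variable {K : Type*} [Field K] [NumberField K]

/-- A finite adele is the sum of its local components. -/
theorem hasSum_finIncl (a : Adele K) :
    HasSum (fun v : FinPlace K => finIncl v (finProj v a)) ((0, a.2) : Adele K) := by
  classical
  -- All partial sums are integral wherever `a` is. They therefore lie in the restricted product
  -- relative to `T`, which has the topology of pointwise convergence and maps continuously to the
  -- finite adeles.
  let T : Set (FinPlace K) := {v | a.2 v ∈ v.Integers}
  have hT : cofinite ≤ 𝓟 T := le_principal_iff.mpr a.2.2
  let y : Finset (FinPlace K) → RestrictedProduct (fun v : FinPlace K => v.Completion)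
      (fun v => (v.Integers : Set v.Completion)) (𝓟 T) := fun S =>
    ⟨fun v => if v ∈ S then a.2 v else 0, mem_principal.mpr fun v hv => by
      change (if v ∈ S then a.2 v else 0) ∈ v.Integers
      split_ifs
      · exact hv
      · exact zero_mem _⟩
  let a' : RestrictedProduct (fun v : FinPlace K => v.Completion)
      (fun v => (v.Integers : Set v.Completion)) (𝓟 T) :=
    ⟨fun v => a.2 v, mem_principal.mpr fun v hv => hv⟩
  have h1 : Tendsto y atTop (𝓝 a') := by
    rw [RestrictedProduct.isEmbedding_coe_of_principal.tendsto_nhds_iff, tendsto_pi_nhds]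
    intro v
    refine tendsto_const_nhds.congr' ?_
    filter_upwards [eventually_ge_atTop {v}] with S hS
    exact (if_pos (Finset.singleton_subset_iff.mp hS)).symm
  have h2 := ((RestrictedProduct.continuous_inclusion hT).tendsto a').comp h1
  have h3 : Tendsto (fun S => ((0, RestrictedProduct.inclusion _ _ hT (y S)) : Adele K)) atTop
      (𝓝 ((0, a.2) : Adele K)) := (tendsto_const_nhds (x := (0 : InfiniteAdeleRing (RealField K)))).prodMk_nhds h2
  refine h3.congr fun S => ?_
  have hinf : ∀ v : InfPlace K, infProj v (∑ w ∈ S, finIncl w (finProj w a)) = 0 := fun v => by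
    rw [map_sum]
    exact Finset.sum_eq_zero fun w _ => rfl
  have hfin : ∀ v : FinPlace K, finProj v (∑ w ∈ S, finIncl w (finProj w a))
      = if v ∈ S then a.2 v else 0 := fun v => by
    rw [map_sum]
    have : ∀ w, finProj v (finIncl w (finProj w a)) = if v = w then a.2 v else 0 := by
      intro w
      change (Pi.single w (a.2 w) : (w : FinPlace K) → w.Completion) v = _
      split_ifs with h
      · subst h
        exact Pi.single_eq_same _ _
      · exact Pi.single_eq_of_ne h _
    simp_rw [this]
    exact Finset.sum_ite_eq S v _
  refine Prod.ext (funext fun v => (hinf v).symm) (FiniteAdeleRing.ext _ fun v => (hfin v).symm)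

theorem sum_infIncl (a : Adele K) :
    ∑ v : InfPlace K, infIncl v (infProj v a) = ((a.1, 0) : Adele K) := by
  classical
  have hfin : ∀ v : FinPlace K, finProj v (∑ w, infIncl w (infProj w a)) = 0 := fun v => by
    rw [map_sum]
    exact Finset.sum_eq_zero fun w _ => rfl
  have hinf : ∀ v : InfPlace K, infProj v (∑ w, infIncl w (infProj w a)) = a.1 v := fun v => by
    rw [map_sum, Finset.sum_eq_single v]
    · exact Pi.single_eq_same (M := fun w : InfPlace K => w.Completion) v (a.1 v)
    · intro w _ hw
      exact Pi.single_eq_of_ne (M := fun w : InfPlace K => w.Completion) hw.symm (a.1 w)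
    · simp
  exact Prod.ext (funext hinf) (FiniteAdeleRing.ext _ hfin)

theorem infIncl_mul_finIncl (v : InfPlace K) (w : FinPlace K) (x : v.Completion)
    (y : w.Completion) : infIncl v x * finIncl w y = 0 :=
  Prod.ext (mul_zero _) (zero_mul _)

theorem infIncl_mul_infIncl {v w : InfPlace K} (h : v ≠ w) (x : v.Completion)
    (y : w.Completion) : infIncl v x * infIncl w y = 0 := by
  classical
  refine Prod.ext (funext fun u => ?_) (zero_mul _)
  change (Pi.single v x : (w : InfPlace K) → w.Completion) u *
    (Pi.single w y : (w : InfPlace K) → w.Completion) u = 0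
  rcases eq_or_ne u v with rfl | hu
  · rw [Pi.single_eq_of_ne h y, mul_zero]
  · rw [Pi.single_eq_of_ne hu x, zero_mul]

theorem finIncl_mul_finIncl {v w : FinPlace K} (h : v ≠ w) (x : v.Completion)
    (y : w.Completion) : finIncl v x * finIncl w y = 0 := by
  classical
  refine Prod.ext (zero_mul _) (FiniteAdeleRing.ext _ fun u => ?_)
  change (Pi.single v x : (w : FinPlace K) → w.Completion) u *
    (Pi.single w y : (w : FinPlace K) → w.Completion) u = 0
  rcases eq_or_ne u v with rfl | hu
  · rw [Pi.single_eq_of_ne h y, mul_zero]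
  · rw [Pi.single_eq_of_ne hu x, zero_mul]

/-- Almost all components of an idele have absolute value `1`. -/
theorem eventually_norm_finProj_eq_one {a : Adele K} (ha : IsUnit a) :
    ∀ᶠ v : FinPlace K in cofinite, ‖finProj v a‖ = 1 := by
  obtain ⟨u, rfl⟩ := ha
  have h1 : ∀ᶠ v : FinPlace K in cofinite, u.val.2 v ∈ v.Integers := u.val.2.2
  have h2 : ∀ᶠ v : FinPlace K in cofinite, u.inv.2 v ∈ v.Integers := u.inv.2.2
  filter_upwards [h1, h2] with v hv1 hv2
  have h3 : ‖finProj v u.val‖ ≤ 1 := (adicCompletion_norm_le_one_iff v _).mpr hv1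
  have h4 : ‖finProj v u.inv‖ ≤ 1 := (adicCompletion_norm_le_one_iff v _).mpr hv2
  have h5 : ‖finProj v u.val‖ * ‖finProj v u.inv‖ = 1 := by
    rw [← norm_mul, ← map_mul, u.val_inv, map_one, norm_one]
  refine le_antisymm h3 ?_
  calc (1 : ℝ) = ‖finProj v u.val‖ * ‖finProj v u.inv‖ := h5.symm
    _ ≤ ‖finProj v u.val‖ := mul_le_of_le_one_right (norm_nonneg _) h4

end Adele

/-! ### Local components of ideles of `K`, and Hecke characters -/

section TensorIncl

variable {K : Type*} [Field K]

theorem tensorIncl_mul_tensorIncl {R R' S : Type*} [CommRing R] [Algebra (RealField K) R]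
    [CommRing R'] [Algebra (RealField K) R'] [CommRing S] [Algebra (RealField K) S]
    {ι : R →ₗ[RealField K] S} {ι' : R' →ₗ[RealField K] S} (h : ∀ x y, ι x * ι' y = 0)
    (x : KTensor K R) (y : KTensor K R') : tensorIncl ι x * tensorIncl ι' y = 0 := by
  have hj : ∀ (x : R ⊗[RealField K] K) (y : R' ⊗[RealField K] K),
      ι.rTensor K x * ι'.rTensor K y = 0 := by
    intro x y
    induction x using TensorProduct.induction_on with
    | zero => simp
    | add a b ha hb => simp only [add_mul, map_add, ha, hb, add_zero]
    | tmul a b =>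
      induction y using TensorProduct.induction_on with
      | zero => simp
      | add c d hc hd => simp only [mul_add, map_add, hc, hd, add_zero]
      | tmul c d => simp [h]
  exact hj x y

variable [NumberField K]

/-- An element of `𝔸_K` is the sum of its local components. -/
theorem hasSum_tensorIncl (y : KTensor K (Adele K)) :
    HasSum (fun v : FinPlace K => tensorIncl (finIncl v) (KTensor.map K (finProj v) y))
      (y - ∑ v : InfPlace K, tensorIncl (infIncl v) (KTensor.map K (infProj v) y)) := by
  induction y using TensorProduct.induction_on with
  | zero =>
    change HasSum (fun v : FinPlace K => tensorIncl (finIncl v)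
        (KTensor.map K (finProj v) (0 : KTensor K (Adele K))))
      ((0 : KTensor K (Adele K)) - ∑ v : InfPlace K, tensorIncl (infIncl v)
        (KTensor.map K (infProj v) (0 : KTensor K (Adele K))))
    simp only [map_zero, Finset.sum_const_zero, sub_zero]
    exact hasSum_zero
  | add a b ha hb =>
    let a' : KTensor K (Adele K) := a
    let b' : KTensor K (Adele K) := b
    change HasSum (fun v : FinPlace K => tensorIncl (finIncl v)
        (KTensor.map K (finProj v) (a' + b')))
      (a' + b' - ∑ v : InfPlace K, tensorIncl (infIncl v) (KTensor.map K (infProj v) (a' + b')))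
    simp only [map_add, Finset.sum_add_distrib, add_sub_add_comm]
    exact ha.add hb
  | tmul a k =>
    let k' : KTensor K (Adele K) := (1 : Adele K) ⊗ₜ[RealField K] k
    have hs : ∀ b : Adele K, b • k' = b ⊗ₜ[RealField K] k := fun b => by
      change b • ((1 : Adele K) ⊗ₜ[RealField K] k) = _
      rw [TensorProduct.smul_tmul', smul_eq_mul, mul_one]
    let y : KTensor K (Adele K) := a ⊗ₜ[RealField K] k
    let a₁ : Adele K := (a.1, 0)
    let a₂ : Adele K := (0, a.2)
    -- The expansion of the finite adele `a₂` is multiplied by the fixed vector `1 ⊗ k`, which is a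
    -- continuous operation.
    have h1 : HasSum _ (a₂ • k') := (hasSum_finIncl a).smul_const k'
    have h2 : a₂ • k' = y -
        ∑ v : InfPlace K, tensorIncl (infIncl v)
          (KTensor.map K (infProj v) y) := by
      have h3 : ∑ v : InfPlace K, tensorIncl (infIncl v)
          (KTensor.map K (infProj v) y)
          = a₁ • k' := by
        rw [show a₁ = _ from (sum_infIncl a).symm, Finset.sum_smul]
        exact Finset.sum_congr rfl fun v _ => (hs _).symm
      have h4 : a₂ = a - a₁ := Prod.ext (sub_self a.1).symm (sub_zero a.2).symm
      rw [h3, h4, sub_smul]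
      exact congrArg (· - a₁ • k') (hs a)
    rw [h2] at h1
    exact h1.congr fun S => Finset.sum_congr rfl fun v _ => hs _

/-- All cross terms vanish. Products of ideles supported at distinct places thus become sums, to
which `hasSum_tensorIncl` applies. -/
theorem prod_one_add_of_orthogonal {ι A : Type*} [CommRing A] (S : Finset ι) (e : ι → A)
    (h : ∀ i j, i ≠ j → e i * e j = 0) : ∏ i ∈ S, (1 + e i) = 1 + ∑ i ∈ S, e i := by
  classical
  induction S using Finset.induction_on with
  | empty => simp
  | insert i S hi ih =>
    have h0 : e i * ∑ j ∈ S, e j = 0 := by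
      rw [Finset.mul_sum]
      exact Finset.sum_eq_zero fun j hj => h i j (ne_of_mem_of_not_mem hj hi).symm
    rw [Finset.prod_insert hi, Finset.sum_insert hi, ih, add_mul, one_mul, mul_add, mul_one, h0]
    ring

/-- The local component at an infinite place of an idele of `K`. -/
def infComponent (v : InfPlace K) : (KTensor K (Adele K))ˣ →* (KTensor K v.Completion)ˣ :=
  Units.map (KTensor.map K (infProj v)).toMonoidHom

/-- The local component at a finite place of an idele of `K`. -/
def finComponent (v : FinPlace K) : (KTensor K (Adele K))ˣ →* (KTensor K v.Completion)ˣ :=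
  Units.map (KTensor.map K (finProj v)).toMonoidHom

/-- With `y = x - 1`, the local component of `x` at `v`, seen as an idele, is 1 plus the `v`-part of
`y`. By orthogonality the products are 1 plus partial sums of the expansion of `y`. -/
theorem tendsto_val_prod_units (x : (KTensor K (Adele K))ˣ) :
    Tendsto (fun S : Finset (FinPlace K) =>
      (((∏ v : InfPlace K, infUnit v (infComponent v x)) *
        ∏ v ∈ S, finUnit v (finComponent v x) : (KTensor K (Adele K))ˣ) : KTensor K (Adele K)))
      atTop (𝓝 (x : KTensor K (Adele K))) := by
  let y : KTensor K (Adele K) := x - 1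
  let A : InfPlace K → KTensor K (Adele K) := fun v =>
    tensorIncl (infIncl v) (KTensor.map K (infProj v) y)
  let B : FinPlace K → KTensor K (Adele K) := fun v =>
    tensorIncl (finIncl v) (KTensor.map K (finProj v) y)
  have hA : ∀ v, ((infUnit v (infComponent v x) : (KTensor K (Adele K))ˣ) : KTensor K (Adele K))
      = 1 + A v := fun v => by
    change 1 + tensorIncl (infIncl v) (KTensor.map K (infProj v) (x : KTensor K (Adele K)) - 1) = _
    rw [← map_one (KTensor.map K (infProj v)), ← map_sub]
  have hB : ∀ v, ((finUnit v (finComponent v x) : (KTensor K (Adele K))ˣ) : KTensor K (Adele K))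
      = 1 + B v := fun v => by
    change 1 + tensorIncl (finIncl v) (KTensor.map K (finProj v) (x : KTensor K (Adele K)) - 1) = _
    rw [← map_one (KTensor.map K (finProj v)), ← map_sub]
  have hprod : ∀ S : Finset (FinPlace K),
      (((∏ v : InfPlace K, infUnit v (infComponent v x)) *
        ∏ v ∈ S, finUnit v (finComponent v x) : (KTensor K (Adele K))ˣ) : KTensor K (Adele K))
      = (1 + ∑ v, A v) + ∑ v ∈ S, B v := by
    intro S
    rw [Units.val_mul, Units.coe_prod, Units.coe_prod]
    simp_rw [hA, hB]
    rw [prod_one_add_of_orthogonal _ A fun v w h =>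
        tensorIncl_mul_tensorIncl (infIncl_mul_infIncl h) _ _,
      prod_one_add_of_orthogonal _ B fun v w h =>
        tensorIncl_mul_tensorIncl (finIncl_mul_finIncl h) _ _]
    have h0 : (∑ v, A v) * ∑ v ∈ S, B v = 0 := by
      rw [Finset.sum_mul_sum]
      exact Finset.sum_eq_zero fun v _ => Finset.sum_eq_zero fun w _ =>
        tensorIncl_mul_tensorIncl (infIncl_mul_finIncl v w) _ _
    rw [add_mul, one_mul, mul_add, mul_one, h0]
    ring
  simp_rw [hprod]
  have h1 : Tendsto (fun S : Finset (FinPlace K) => (1 + ∑ v, A v) + ∑ v ∈ S, B v) atTop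
      (𝓝 ((1 + ∑ v, A v) + (y - ∑ v, A v))) := (hasSum_tensorIncl y).const_add _
  have h2 : (1 + ∑ v, A v) + (y - ∑ v, A v) = x := by
    change (1 + ∑ v, A v) + ((x : KTensor K (Adele K)) - 1 - ∑ v, A v) = x
    ring
  rwa [h2] at h1

/-- An idele of `K` is the product of its local components. -/
theorem tendsto_prod_units (x : (KTensor K (Adele K))ˣ) :
    Tendsto (fun S : Finset (FinPlace K) => (∏ v : InfPlace K, infUnit v (infComponent v x)) *
        ∏ v ∈ S, finUnit v (finComponent v x)) atTop (𝓝 x) := by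
  -- The topology on units also demands convergence of the inverses, which is the previous lemma for
  -- `x⁻¹`.
  rw [Units.isEmbedding_embedProduct.tendsto_nhds_iff]
  refine (tendsto_val_prod_units x).prodMk_nhds
    ((MulOpposite.continuous_op.tendsto _).comp ((tendsto_val_prod_units x⁻¹).congr fun S => ?_))
  simp only [map_inv, Finset.prod_inv_distrib, mul_inv]

/-- The value of a Hecke character at an idele is the product of its local values. -/
theorem UnitaryHeckeCharacter.hasProd (χ : UnitaryHeckeCharacter K) (x : (KTensor K (Adele K))ˣ) :
    HasProd (fun v : FinPlace K => (χ.toHom (finUnit v (finComponent v x)) : ℂ))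
      ((∏ v : InfPlace K, (χ.toHom (infUnit v (infComponent v x)) : ℂ))⁻¹ * χ.toHom x) := by
  let ψ : (KTensor K (Adele K))ˣ →* ℂ := Circle.coeHom.comp χ.toHom
  have hψ : Continuous ψ :=
    (continuous_subtype_val (p := (· ∈ Submonoid.unitSphere ℂ))).comp χ.continuous_toHom
  -- Continuity of the character carries the limit over to `ℂ`; the constant archimedean factor is
  -- divided out.
  have h1 := ((hψ.tendsto x).comp (tendsto_prod_units x)).const_mul
    (∏ v : InfPlace K, ψ (infUnit v (infComponent v x)))⁻¹
  refine h1.congr fun S => ?_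
  have h2 : ∏ v : InfPlace K, ψ (infUnit v (infComponent v x)) ≠ 0 :=
    Finset.prod_ne_zero_iff.mpr fun v _ => Circle.coe_ne_zero _
  rw [Function.comp_apply, map_mul, map_prod, map_prod, inv_mul_cancel_left₀ h2]
  rfl

end TensorIncl

/-! ## The transformation of the global Fourier coefficients -/

theorem ofReal_prod_cpow {ι : Type*} (S : Finset ι) (a : ι → ℝ) (ha : ∀ i, 0 ≤ a i) (z : ℂ) :
    ((∏ i ∈ S, a i : ℝ) : ℂ) ^ z = ∏ i ∈ S, (a i : ℂ) ^ z := by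
  classical
  induction S using Finset.induction_on with
  | empty => simp
  | insert i S hi ih =>
    rw [Finset.prod_insert hi, Finset.prod_insert hi, Complex.ofReal_mul,
      Complex.mul_cpow_ofReal_nonneg (ha i) (Finset.prod_nonneg fun j _ => ha j), ih]

/-! ### Complex powers of the adelic norm -/

section AdelicNorm

variable {K : Type*} [Field K] [NumberField K]

/-- Almost all factors are 1, so the product is finite; complex powers are multiplicative on
nonnegative reals. -/
theorem hasProd_norm_finProj_cpow {a : Adele K} (ha : IsUnit a) (z : ℂ) :
    HasProd (fun v : FinPlace K => (‖finProj v a‖ : ℂ) ^ z)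
      (((∏ᶠ v : FinPlace K, ‖finProj v a‖ : ℝ) : ℂ) ^ z) := by
  have hfin : {v : FinPlace K | ¬ ‖finProj v a‖ = 1}.Finite := eventually_norm_finProj_eq_one ha
  rw [finprod_eq_prod_of_mulSupport_subset (s := hfin.toFinset) _ (by
      intro v hv
      simpa using hv),
    ofReal_prod_cpow _ _ fun v => norm_nonneg _]
  refine hasProd_prod_of_ne_finset_one fun v hv => ?_
  have h1 : ‖finProj v a‖ = 1 := by simpa using hv
  rw [h1, Complex.ofReal_one, Complex.one_cpow]

theorem norm_infProj_pos {a : Adele K} (ha : IsUnit a) (v : InfPlace K) : 0 < ‖infProj v a‖ :=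
  norm_pos_iff.mpr (ha.map (infProj v)).ne_zero

theorem norm_finProj_pos {a : Adele K} (ha : IsUnit a) (v : FinPlace K) : 0 < ‖finProj v a‖ :=
  norm_pos_iff.mpr (ha.map (finProj v)).ne_zero

theorem finprod_norm_finProj_pos {a : Adele K} (ha : IsUnit a) :
    0 < ∏ᶠ v : FinPlace K, ‖finProj v a‖ :=
  finprod_induction (0 < ·) one_pos (fun _ _ => mul_pos) fun v => norm_finProj_pos ha v

theorem adelicNorm_pos {a : Adele K} (ha : IsUnit a) : 0 < adelicNorm a :=
  mul_pos (Finset.prod_pos fun v _ => norm_infProj_pos ha v) (finprod_norm_finProj_pos ha)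

theorem adelicNorm_cpow (a : Adele K) (z : ℂ) :
    (adelicNorm a : ℂ) ^ z = (∏ v : InfPlace K, (‖infProj v a‖ : ℂ) ^ z) *
      ((∏ᶠ v : FinPlace K, ‖finProj v a‖ : ℝ) : ℂ) ^ z := by
  rw [adelicNorm, Complex.ofReal_mul, Complex.mul_cpow_ofReal_nonneg
    (Finset.prod_nonneg fun v _ => norm_nonneg _) (finprod_nonneg fun v => norm_nonneg _),
    ofReal_prod_cpow _ _ fun v => norm_nonneg _]

end AdelicNorm

section Transformation

variable {K : Type*} [Field K] [NumberField K] [IsCMField K] {n : ℕ}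

theorem det_star_inv_map {R S : Type*} [CommRing R] [Algebra (RealField K) R] [CommRing S]
    [Algebra (RealField K) S] (φ : R →ₐ[RealField K] S) (h : GL (Fin n) (KTensor K R)) :
    GeneralLinearGroup.det (star (GeneralLinearGroup.map (KTensor.map K φ) h))⁻¹ =
      Units.map (KTensor.map K φ).toMonoidHom (GeneralLinearGroup.det (star h)⁻¹) := by
  rw [← GL_map_star, ← map_inv]
  apply Units.ext
  exact (RingHom.map_det (KTensor.map K φ) _).symm

/-- The local result for components of global data: `φ` is to be a projection `𝔸_E → E_v`, and all
factors are expressed through the adelic `h`. -/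
theorem localCoeff_map_eq {F : Type*} [NontriviallyNormedField F] [CompleteSpace F]
    [LocallyCompactSpace F] [SecondCountableTopology F] [MeasurableSpace F] [BorelSpace F]
    [Algebra (RealField K) F] {R : Type*} [CommRing R] [Algebra (RealField K) R]
    (φ : R →ₐ[RealField K] F) {μ : Measure F} [Measure.IsAddHaarMeasure μ] (hμ : ScaledByNorm μ)
    {χ : (KTensor K F)ˣ →* Circle} {s : ℂ} {f : U K n F → ℂ} (hf : IsLocalSection norm χ s f)
    (e : F → ℂ) (β : Her K n R) (h : GL (Fin n) (KTensor K R)) (L : Set (Her K n F)) (c : ℝ≥0∞) :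
    (Integrable (localIntegrand e f (β.map φ) (GeneralLinearGroup.map (KTensor.map K φ) h))
        (haarNormalized K n F L c) ↔
      Integrable (localIntegrand e f ((Her.act h⁻¹ β).map φ)
        (GeneralLinearGroup.map (KTensor.map K φ) 1)) (haarNormalized K n F L c)) ∧
    ∫ m, localIntegrand e f (β.map φ) (GeneralLinearGroup.map (KTensor.map K φ) h) m
        ∂(haarNormalized K n F L c) =
      χ (Units.map (KTensor.map K φ).toMonoidHom (GeneralLinearGroup.det (star h)⁻¹)) *
        (‖φ (KTensor.descend K R (((star h)⁻¹).val * (h⁻¹).val).det)‖ : ℂ) ^ ((n : ℂ) - s) *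
        ∫ m, localIntegrand e f ((Her.act h⁻¹ β).map φ)
          (GeneralLinearGroup.map (KTensor.map K φ) 1) m ∂(haarNormalized K n F L c) := by
  have key := localCoeff_eq hμ hf e (β.map φ) (GeneralLinearGroup.map (KTensor.map K φ) h) L c
  rwa [descend_det_map, det_star_inv_map, ← map_inv, ← Her.map_act,
    ← map_one (GeneralLinearGroup.map (KTensor.map K φ))] at key

theorem isUnit_descend_det (h : GL (Fin n) (KTensor K (Adele K))) :
    IsUnit (KTensor.descend K (Adele K) (((star h)⁻¹).val * (h⁻¹).val).det) := by
  rw [descend_det_star_inv_mul_inv]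
  exact isUnit_norm_det _

namespace FactorizableSection

variable {χ : UnitaryHeckeCharacter K} {s : ℂ} (f : FactorizableSection χ s n)
  (β : Her K n (Adele K)) (h : GL (Fin n) (KTensor K (Adele K)))

theorem inf_transform (v : InfPlace K) :
    (Integrable (f.infIntegrand β h v) (infMeasure n v) ↔
      Integrable (f.infIntegrand (Her.act h⁻¹ β) 1 v) (infMeasure n v)) ∧
    f.infCoeff β h v =
      χ.toHom (infUnit v (infComponent v (GeneralLinearGroup.det (star h)⁻¹))) *
        (‖infProj v (KTensor.descend K (Adele K) (((star h)⁻¹).val * (h⁻¹).val).det)‖ : ℂ) ^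
          ((n : ℂ) - s) * f.infCoeff (Her.act h⁻¹ β) 1 v := by
  -- The σ-algebra on `E_v` is auxiliary: it serves only to compute the Jacobian and does not occur
  -- in the conclusion.
  let _ : MeasurableSpace v.Completion := borel _
  have _ : BorelSpace v.Completion := ⟨rfl⟩
  let _ := nontriviallyNormedFieldCompletion v
  obtain ⟨μ, hμ1, hμ⟩ := exists_scaledByNorm_inf v
  exact localCoeff_map_eq (infProj v) hμ (f.inf_mem v) (infChar v) β h
    {m | ∀ i j, localAbs norm (m.mat i j) ≤ 1}
    (ENNReal.ofReal (2 ^ n * Real.pi ^ (n * (n - 1) / 2)))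

theorem fin_transform (v : FinPlace K) :
    (Integrable (f.finIntegrand β h v) (finMeasure n v) ↔
      Integrable (f.finIntegrand (Her.act h⁻¹ β) 1 v) (finMeasure n v)) ∧
    f.finCoeff β h v =
      χ.toHom (finUnit v (finComponent v (GeneralLinearGroup.det (star h)⁻¹))) *
        (‖finProj v (KTensor.descend K (Adele K) (((star h)⁻¹).val * (h⁻¹).val).det)‖ : ℂ) ^
          ((n : ℂ) - s) * f.finCoeff (Her.act h⁻¹ β) 1 v := by
  let _ : MeasurableSpace v.Completion := borel _
  have _ : BorelSpace v.Completion := ⟨rfl⟩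
  let _ := nontriviallyNormedFieldAdicCompletion v
  obtain ⟨μ, hμ1, hμ⟩ := exists_scaledByNorm_fin v
  exact localCoeff_map_eq (finProj v) hμ (f.fin_mem v) (finChar v) β h
    {m | ∀ i j, m.mat i j ∈ integers v} 1

/-- The product of the factors that relate the local coefficients at the finite places. -/
theorem hasProd_finFactor :
    HasProd (fun v : FinPlace K =>
      (χ.toHom (finUnit v (finComponent v (GeneralLinearGroup.det (star h)⁻¹))) : ℂ) *
        (‖finProj v (KTensor.descend K (Adele K) (((star h)⁻¹).val * (h⁻¹).val).det)‖ : ℂ) ^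
          ((n : ℂ) - s))
      (((∏ v : InfPlace K,
          (χ.toHom (infUnit v (infComponent v (GeneralLinearGroup.det (star h)⁻¹))) : ℂ))⁻¹ *
        χ.toHom (GeneralLinearGroup.det (star h)⁻¹)) *
        ((∏ᶠ v : FinPlace K, ‖finProj v
          (KTensor.descend K (Adele K) (((star h)⁻¹).val * (h⁻¹).val).det)‖ : ℝ) : ℂ) ^
            ((n : ℂ) - s)) :=
  (χ.hasProd _).mul (hasProd_norm_finProj_cpow (isUnit_descend_det h) _)

/-- Convergence of the Fourier coefficients for `(β, h)` and for `(h⁻¹ β ᵗh̄⁻¹, 1)`. -/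
theorem coeffConverges_iff :
    f.CoeffConverges β h ↔ f.CoeffConverges (Her.act h⁻¹ β) 1 := by
  have hP := hasProd_finFactor (χ := χ) (s := s) h
  have hf := fun v => (f.fin_transform β h v).2
  refine and_congr (forall_congr' fun v => (f.inf_transform β h v).1)
    (and_congr (forall_congr' fun v => (f.fin_transform β h v).1) ⟨fun hm => ?_, fun hm => ?_⟩)
  · have hne : ∀ v : FinPlace K,
        (χ.toHom (finUnit v (finComponent v (GeneralLinearGroup.det (star h)⁻¹))) : ℂ) *
          (‖finProj v (KTensor.descend K (Adele K) (((star h)⁻¹).val * (h⁻¹).val).det)‖ : ℂ) ^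
            ((n : ℂ) - s) ≠ 0 := fun v =>
      mul_ne_zero (Circle.coe_ne_zero _)
        (ofReal_cpow_ne_zero (norm_finProj_pos (isUnit_descend_det h) v) _)
    -- A convergent product of nonzero factors can still be 0, and then the inverses need not be
    -- multipliable. The limit itself must therefore be nonzero.
    have hne' : ((∏ v : InfPlace K,
          (χ.toHom (infUnit v (infComponent v (GeneralLinearGroup.det (star h)⁻¹))) : ℂ))⁻¹ *
        χ.toHom (GeneralLinearGroup.det (star h)⁻¹)) *
        ((∏ᶠ v : FinPlace K, ‖finProj v
          (KTensor.descend K (Adele K) (((star h)⁻¹).val * (h⁻¹).val).det)‖ : ℝ) : ℂ) ^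
            ((n : ℂ) - s) ≠ 0 :=
      mul_ne_zero (mul_ne_zero (inv_ne_zero (Finset.prod_ne_zero_iff.mpr fun v _ =>
        Circle.coe_ne_zero _)) (Circle.coe_ne_zero _))
        (ofReal_cpow_ne_zero (finprod_norm_finProj_pos (isUnit_descend_det h)) _)
    refine ((hP.inv₀ hne').multipliable.mul hm).congr fun v => ?_
    rw [hf, ← mul_assoc, inv_mul_cancel₀ (hne v), one_mul]
  · exact (hP.multipliable.mul hm).congr fun v => (hf v).symm

/-- The Fourier coefficients for `(β, h)` and for `(h⁻¹ β ᵗh̄⁻¹, 1)`. -/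
theorem coeff_eq (hc : f.CoeffConverges β h) :
    f.coeff β h = (χ.toHom (GeneralLinearGroup.det (star h)⁻¹) : ℂ) *
      (adelicNorm (KTensor.descend K (Adele K) (((star h)⁻¹).val * (h⁻¹).val).det) : ℂ) ^
        ((n : ℂ) - s) * f.coeff (Her.act h⁻¹ β) 1 := by
  have hP := hasProd_finFactor (χ := χ) (s := s) h
  have hm := ((f.coeffConverges_iff β h).mp hc).2.2
  have hne : (∏ v : InfPlace K,
      (χ.toHom (infUnit v (infComponent v (GeneralLinearGroup.det (star h)⁻¹))) : ℂ)) ≠ 0 :=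
    Finset.prod_ne_zero_iff.mpr fun v _ => Circle.coe_ne_zero _
  have h1 := fun v => (f.inf_transform β h v).2
  have h2 := fun v => (f.fin_transform β h v).2
  rw [coeff, coeff, adelicNorm_cpow]
  simp_rw [h1, h2]
  -- The value of the finite part contains the inverse of the archimedean character values, which
  -- cancels against the factors from the infinite places.
  rw [hP.multipliable.tprod_mul hm, hP.tprod_eq, Finset.prod_mul_distrib, Finset.prod_mul_distrib]
  field_simp

end FactorizableSection

/-- The identity for analytic continuations of the Fourier coefficients. -/
theorem eqOn_of_coeff_eq {χ : UnitaryHeckeCharacter K} (β : Her K n (Adele K))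
    (h : GL (Fin n) (KTensor K (Adele K))) (f : ∀ s : ℂ, FactorizableSection χ s n) {D : Set ℂ}
    {F F₁ : ℂ → ℂ} {s₀ : ℂ} (hD : IsPreconnected D) (hs₀ : s₀ ∈ D) (hF : AnalyticOnNhd ℂ F D)
    (hF₁ : AnalyticOnNhd ℂ F₁ D)
    (hc : ∀ᶠ s in 𝓝 s₀, (f s).CoeffConverges β h ∧ F s = (f s).coeff β h ∧
      F₁ s = (f s).coeff (Her.act h⁻¹ β) 1) :
    ∀ s ∈ D, F s = (χ.toHom (GeneralLinearGroup.det (star h)⁻¹) : ℂ) *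
      (adelicNorm (KTensor.descend K (Adele K) (((star h)⁻¹).val * (h⁻¹).val).det) : ℂ) ^
        ((n : ℂ) - s) * F₁ s := by
  have hpos := adelicNorm_pos (isUnit_descend_det h)
  -- Identity theorem: both sides are analytic on `D`, the power of the positive adelic norm being
  -- entire in `s`, and they agree near `s₀`.
  refine hF.eqOn_of_preconnected_of_eventuallyEq ?_ hD hs₀ ?_
  · have hd : Differentiable ℂ fun s : ℂ => (adelicNorm (KTensor.descend K (Adele K)
        (((star h)⁻¹).val * (h⁻¹).val).det) : ℂ) ^ ((n : ℂ) - s) :=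
      ((differentiable_const (n : ℂ)).sub differentiable_id).const_cpow
        (Or.inl (by exact_mod_cast hpos.ne'))
    exact (analyticOnNhd_const.mul fun s _ => hd.analyticAt s).mul hF₁
  · filter_upwards [hc] with s hs
    rw [hs.2.1, hs.2.2, (f s).coeff_eq β h hs.1]

end Transformation

end SiegelEisenstein

end

open SiegelEisenstein in
theorem lemma9 (K : Type*) [Field K] [NumberField K] [IsCMField K]
    (χ : UnitaryHeckeCharacter K) (n : ℕ)
    (h : GL (Fin n) (KTensor K (Adele K)))
    (β : selfAdjoint (Matrix (Fin n) (Fin n) K)) :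
    (∀ (s : ℂ) (f : FactorizableSection χ s n),
      (f.CoeffConverges (Her.ofField (Adele K) β) h ↔
        f.CoeffConverges (Her.act h⁻¹ (Her.ofField (Adele K) β)) 1) ∧
      (f.CoeffConverges (Her.ofField (Adele K) β) h →
        f.coeff (Her.ofField (Adele K) β) h =
          (χ.toHom (GeneralLinearGroup.det (star h)⁻¹) : ℂ) *
            (adelicNorm (KTensor.descend K (Adele K)
              (((star h)⁻¹).val * (h⁻¹).val).det) : ℂ) ^ ((n : ℂ) - s) *
            f.coeff (Her.act h⁻¹ (Her.ofField (Adele K) β)) 1)) ∧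
    (∀ (f : ∀ s : ℂ, FactorizableSection χ s n) (D : Set ℂ) (F F₁ : ℂ → ℂ) (s₀ : ℂ),
      IsOpen D → IsPreconnected D → s₀ ∈ D →
      AnalyticOnNhd ℂ F D → AnalyticOnNhd ℂ F₁ D →
      (∀ᶠ s in 𝓝 s₀, (f s).CoeffConverges (Her.ofField (Adele K) β) h ∧
        F s = (f s).coeff (Her.ofField (Adele K) β) h ∧
        F₁ s = (f s).coeff (Her.act h⁻¹ (Her.ofField (Adele K) β)) 1) →
      ∀ s ∈ D, F s =
        (χ.toHom (GeneralLinearGroup.det (star h)⁻¹) : ℂ) *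
          (adelicNorm (KTensor.descend K (Adele K)
            (((star h)⁻¹).val * (h⁻¹).val).det) : ℂ) ^ ((n : ℂ) - s) * F₁ s) := by
  exact ⟨fun s f => ⟨f.coeffConverges_iff _ h, f.coeff_eq _ h⟩, fun f D F F₁ s₀ _ hD hs₀ hF hF₁ hc =>
    eqOn_of_coeff_eq _ h f hD hs₀ hF hF₁ hc⟩
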